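/- **Setting.** $(X,d,\mu)$ is a space of homogeneous type: $d:X\times X\to[0,\infty)$ is symmetric, $d(x,y)=0$ iff $x=y$, $d(x,y)\le A_0[d(x,z)+d(z,y)]$ with $A_0\ge 1$, and $\mu$ is a measure (on a $\sigma$-algebra containing all balls $B(x,r)=\{y:d(x,y)<r\}$ and all Borel sets) with $\mu(B(x,2r))\le C_\mu\,\mu(B(x,r))<\infty$ for all $x\in X$, $r>0$; moreover $\mu(X)=\infty$ and $\mu(\{x\})=0$ for every $x\in X$. A set $U$ is open if each $x\in U$ has a ball $B(x,\varepsilon)\subseteq U$, $\varepsilon>0$. A *system of dyadic cubes* with parameters $\delta\in(0,1)$, $0<c_1\le C_1$, $M\in\mathbb N$ is a family $\mathcal D=\bigcup_{k\in\mathbb Z}\mathcal D_k$, where each $\mathcal D_k$ is a countable family of Borel sets $Q^k_\alpha$ with center points $x^k_\alpha$, such that: for every $k$, $X$ is the disjoint union of the $Q^k_\alpha$; if $\ell\ge k$ then $Q^\ell_\beta\subseteq Q^k_\alpha$ or $Q^\ell_\beta\cap Q^k_\alpha=\emptyset$; for each $(k,\alpha)$ and $\ell\le k$ there is a unique $\beta$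 with $Q^k_\alpha\subseteq Q^\ell_\beta$; each $Q^k_\alpha$ contains at most $M$ cubes $Q^{k+1}_\beta$ and is their union; $B(x^k_\alpha,c_1\delta^k)\subseteq Q^k_\alpha\subseteq B(x^k_\alpha,C_1\delta^k)$; and if $\ell\ge k$ and $Q^\ell_\beta\subseteq Q^k_\alpha$, then $B(x^\ell_\beta,C_1\delta^\ell)\subseteq B(x^k_\alpha,C_1\delta^k)$. Systems $\mathcal D^1,\dots,\mathcal D^T$ with these parameters are *adjacent* with constant $C_{\rm adj}\ge1$ if for every $x\in X$, $k\in\mathbb Z$ and $\delta^{k+3}<r\le\delta^{k+2}$ there are $t$ and a cube $Q\in\mathcal D^t$ of generation $k$ with center $z$ such that $d(x,z)<2A_0\delta^k$ and $B(x,r)\subseteq Q\subseteq B(x,C_{\rm adj}r)$. A family $\mathcal S\subseteq\mathcal D$ is *$\eta$-sparse* ($0<\eta<1$) if $\sum_{P\in\mathcal S,\,P\subseteq Q}\mu(P)\le\frac1\eta\mu(Q)$ for every $Q\in\mathcal D$. Write $g_Q=\frac1{\mu(Q)}\int_Q g\,d\mu$. For $b$ integrable on every ball, put $$C_b f(x)=\sup_{B\ni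 x}\frac1{\mu(B)}\int_B|b(x)-b(y)||f(y)|\,d\mu(y)$$ (supremum over all balls $B$ containing $x$), and, for $f\ge 0$, $$\mathcal T_{\mathcal S,b}f(x)=\sum_{Q\in\mathcal S}|b(x)-b_Q|\,f_Q\,\chi_Q(x),\qquad \mathcal T^*_{\mathcal S,b}f(x)=\sum_{Q\in\mathcal S}\Big(\frac1{\mu(Q)}\int_Q|b(y)-b_Q|f(y)\,d\mu(y)\Big)\chi_Q(x),$$ all with values in $[0,\infty]$. **Theorem 3.1.** There are $T,M\in\mathbb N$, parameters $\delta,c_1,C_1,C_{\rm adj}$, $\eta\in(0,1)$ and a constant $C<\infty$, depending only on $A_0$ and $C_\mu$, such that the following holds for every space $(X,d,\mu)$ as above and every complex-valued $b$ that is integrable on every ball. For every complex-valued $f\in L^\infty(X)$ with compact support (that is, vanishing a.e. outside a compact set) there are adjacent systems of dyadic cubes $\mathcal D^1,\dots,\mathcal D^T$ with these parameters, and $\eta$-sparse families $\mathcal S_t\subseteq\mathcal D^t$, $t=1,\dots,T$, such that for a.e. $x\in X$ $$|C_b f(x)|\le C\sum_{t=1}^T\Big(\mathcal T_{\mathcal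 S_t,b}(|f|)(x)+\mathcal T^*_{\mathcal S_t,b}(|f|)(x)\Big).$$ -/

import Mathlib

open MeasureTheory
open scoped ENNReal NNReal Topology

universe u

namespace HomogType

variable {X : Type u}

/-- `d` is a quasi-metric on `X` with quasi-triangle constant `A₀`. -/
structure IsQuasiMetric (d : X → X → ℝ) (A₀ : ℝ) : Prop where
  one_le : 1 ≤ A₀
  nonneg : ∀ x y, 0 ≤ d x y
  symm : ∀ x y, d x y = d y x
  eq_zero_iff : ∀ x y, d x y = 0 ↔ x = y
  triangle : ∀ x y z, d x y ≤ A₀ * (d x z + d z y)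

/-- The quasi-metric ball `B(x, r) = {y | d(x, y) < r}`. -/
def qball (d : X → X → ℝ) (x : X) (r : ℝ) : Set X := {y | d x y < r}

/-- The topology induced by `d`: a set is open if it contains a ball around each of its points.
(Balls themselves need not be open.) -/
@[reducible]
def quasiTopology (d : X → X → ℝ) : TopologicalSpace X where
  IsOpen U := ∀ x ∈ U, ∃ ε > 0, qball d x ε ⊆ U
  isOpen_univ := fun _ _ => ⟨1, one_pos, Set.subset_univ _⟩
  isOpen_inter := by
    intro U V hU hV x hx
    obtain ⟨ε₁, h₁, hs₁⟩ := hU x hx.1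
    obtain ⟨ε₂, h₂, hs₂⟩ := hV x hx.2
    exact ⟨min ε₁ ε₂, lt_min h₁ h₂, fun y hy =>
      ⟨hs₁ (show d x y < ε₁ from lt_of_lt_of_le hy (min_le_left _ _)),
        hs₂ (show d x y < ε₂ from lt_of_lt_of_le hy (min_le_right _ _))⟩⟩
  isOpen_sUnion := by
    intro 𝒰 h𝒰 x hx
    obtain ⟨U, hU, hxU⟩ := hx
    obtain ⟨ε, hε, hs⟩ := h𝒰 U hU x hxU
    exact ⟨ε, hε, hs.trans (Set.subset_sUnion_of_mem hU)⟩

/-- `(X, d, μ)` is a space of homogeneous type in the sense of Coifman and Weiss, with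
quasi-triangle constant `A₀` and doubling constant `Cμ`, such that `μ(X) = ∞` and points have
measure zero.  The `σ`-algebra on which `μ` lives contains the Borel sets and the balls. -/
structure IsSpaceOfHomogeneousType [MeasurableSpace X] (d : X → X → ℝ) (μ : Measure X)
    (A₀ : ℝ) (Cμ : ℝ≥0) : Prop where
  quasiMetric : IsQuasiMetric d A₀
  measurableSet_of_isOpen : ∀ U, IsOpen[quasiTopology d] U → MeasurableSet U
  measurableSet_qball : ∀ x r, MeasurableSet (qball d x r)
  qball_lt_top : ∀ x r, 0 < r → μ (qball d x r) < ∞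
  doubling : ∀ x r, 0 < r → μ (qball d x (2 * r)) ≤ Cμ * μ (qball d x r)
  measure_univ : μ Set.univ = ∞
  measure_singleton : ∀ x, μ {x} = 0

/-- A system of dyadic cubes with parameters `δ ∈ (0, 1)`, `0 < c₁ ≤ C₁`, in which every cube has
at most `M` children.  Cubes of generation `k` are indexed by their center points: `centers k` is
the set of centers of generation `k`, and `cube k z` is the cube of generation `k` and center `z`.
(This loses nothing: the cubes of one generation are disjoint and contain their centers.) -/
structure DyadicSystem (d : X → X → ℝ) (δ c₁ C₁ : ℝ) (M : ℕ) where
  δ_pos : 0 < δ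
  δ_lt_one : δ < 1
  c₁_pos : 0 < c₁
  c₁_le : c₁ ≤ C₁
  centers : ℤ → Set X
  cube : ℤ → X → Set X
  countable_centers : ∀ k, (centers k).Countable
  borel_cube : ∀ k, ∀ z ∈ centers k, MeasurableSet[@borel X (quasiTopology d)] (cube k z)
  cover : ∀ k, ⋃ z ∈ centers k, cube k z = Set.univ
  disjoint : ∀ k, (centers k).PairwiseDisjoint (cube k)
  nested : ∀ k l, k ≤ l → ∀ z ∈ centers k, ∀ w ∈ centers l,
    cube l w ⊆ cube k z ∨ Disjoint (cube k z) (cube l w)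
  ancestor : ∀ k l, l ≤ k → ∀ z ∈ centers k, ∃! w, w ∈ centers l ∧ cube k z ⊆ cube l w
  card_children : ∀ k, ∀ z ∈ centers k,
    {w | w ∈ centers (k + 1) ∧ cube (k + 1) w ⊆ cube k z}.encard ≤ M
  union_children : ∀ k, ∀ z ∈ centers k,
    cube k z = ⋃ w ∈ {w | w ∈ centers (k + 1) ∧ cube (k + 1) w ⊆ cube k z}, cube (k + 1) w
  ball_subset : ∀ k, ∀ z ∈ centers k, qball d z (c₁ * δ ^ k) ⊆ cube k z
  subset_ball : ∀ k, ∀ z ∈ centers k, cube k z ⊆ qball d z (C₁ * δ ^ k)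
  ball_mono : ∀ k l, k ≤ l → ∀ z ∈ centers k, ∀ w ∈ centers l, cube l w ⊆ cube k z →
    qball d w (C₁ * δ ^ l) ⊆ qball d z (C₁ * δ ^ k)

/-- The family of all cubes, of all generations, of a system of dyadic cubes. -/
def DyadicSystem.cubes {d : X → X → ℝ} {δ c₁ C₁ : ℝ} {M : ℕ} (D : DyadicSystem d δ c₁ C₁ M) :
    Set (Set X) :=
  {Q | ∃ k, ∃ z ∈ D.centers k, Q = D.cube k z}

/-- The systems `D t` form a collection of adjacent systems of dyadic cubes, with parameters
`δ, c₁, C₁` and `Cadj`; here `A₀` is the quasi-triangle constant of `d`. -/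
def IsAdjacent {d : X → X → ℝ} {δ c₁ C₁ : ℝ} {M T : ℕ} (A₀ Cadj : ℝ)
    (D : Fin T → DyadicSystem d δ c₁ C₁ M) : Prop :=
  1 ≤ Cadj ∧ ∀ (x : X) (r : ℝ) (k : ℤ), δ ^ (k + 3) < r → r ≤ δ ^ (k + 2) →
    ∃ t, ∃ z ∈ (D t).centers k, d x z < 2 * A₀ * δ ^ k ∧
      qball d x r ⊆ (D t).cube k z ∧ (D t).cube k z ⊆ qball d x (Cadj * r)

/-- A family `S` of cubes of the dyadic system `D` is `η`-sparse (Carleson packing condition). -/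
def IsSparse [MeasurableSpace X] (μ : Measure X) {d : X → X → ℝ} {δ c₁ C₁ : ℝ} {M : ℕ}
    (D : DyadicSystem d δ c₁ C₁ M) (η : ℝ) (S : Set (Set X)) : Prop :=
  S ⊆ D.cubes ∧ ∀ Q ∈ D.cubes,
    ∑' P : {P : Set X // P ∈ S ∧ P ⊆ Q}, μ (P : Set X) ≤ ENNReal.ofReal (1 / η) * μ Q

/-- `b` is locally integrable: integrable over every ball. -/
def LocallyInt [MeasurableSpace X] (d : X → X → ℝ) (μ : Measure X) (b : X → ℂ) : Prop :=
  ∀ x r, IntegrableOn b (qball d x r) μ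

/-- `f` vanishes almost everywhere outside a compact set. -/
def CompactlySupported [MeasurableSpace X] (d : X → X → ℝ) (μ : Measure X) (f : X → ℂ) : Prop :=
  ∃ K : Set X, @IsCompact X (quasiTopology d) K ∧ ∀ᵐ x ∂μ, x ∉ K → f x = 0

/-- The maximal commutator
`C_b f(x) = sup_{B ∋ x} μ(B)⁻¹ ∫_B |b(x) - b(y)| |f(y)| dμ(y)`, the supremum being over all
balls containing `x`. -/
noncomputable def maximalCommutator [MeasurableSpace X] (d : X → X → ℝ) (μ : Measure X)
    (b f : X → ℂ) (x : X) : ℝ≥0∞ :=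
  ⨆ (z : X) (r : ℝ) (_ : 0 < r) (_ : x ∈ qball d z r),
    (μ (qball d z r))⁻¹ * ∫⁻ y in qball d z r, ‖b x - b y‖ₑ * ‖f y‖ₑ ∂μ

/-- `T_{S,b}(|f|)(x) = ∑_{Q ∈ S} |b(x) - b_Q| |f|_Q χ_Q(x)`. -/
noncomputable def sparseOp [MeasurableSpace X] (μ : Measure X) (S : Set (Set X))
    (b f : X → ℂ) (x : X) : ℝ≥0∞ :=
  ∑' Q : S, (Q : Set X).indicator
    (fun x => ‖b x - ⨍ y in (Q : Set X), b y ∂μ‖ₑ *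
      ((μ (Q : Set X))⁻¹ * ∫⁻ y in (Q : Set X), ‖f y‖ₑ ∂μ)) x

/-- `T*_{S,b}(|f|)(x) = ∑_{Q ∈ S} (μ(Q)⁻¹ ∫_Q |b(y) - b_Q| |f(y)| dμ(y)) χ_Q(x)`. -/
noncomputable def sparseOpAdj [MeasurableSpace X] (μ : Measure X) (S : Set (Set X))
    (b f : X → ℂ) (x : X) : ℝ≥0∞ :=
  ∑' Q : S, (Q : Set X).indicator
    (fun _ => (μ (Q : Set X))⁻¹ *
      ∫⁻ y in (Q : Set X), ‖b y - ⨍ z in (Q : Set X), b z ∂μ‖ₑ * ‖f y‖ₑ ∂μ) x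

end HomogType

/-!
The maximal commutator is a supremum over balls. By adjacency every ball lies in a dyadic cube of
comparable measure of one of the systems (`IsAdjacent.exists_mean_le`), so it is enough to
dominate, for a single dyadic system, the means of `|b(x) - b| |f|` over the cubes containing `x`.

For the sparse domination (`DyadicSystem.exists_sparse`), start with the boundedly many cubes `R`
of a large generation that meet the support of `f`. Inside `R`, pass from a cube `Q` to the
maximal cubes `P` in `Q` on which the mean of `|f|`, or that of `|b - b_Q| |f|`, is more than four
times its mean over `Q`. By the weak type inequality for the dyadic maximal function
(`DyadicSystem.measure_sUnion_le`) these occupy at most half of `Q`. A cube in `R` whose current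
stopping cube is `Q` has both means controlled by those over `Q`, and the triangle inequality
`|b(x) - b| ≤ |b(x) - b_Q| + |b - b_Q|` splits the result into a term of `T_{S,b}` and one of
`T*_{S,b}`. Since the comparison is with stopping cubes, no differentiation theorem is needed, and
the estimate holds at every point. The cubes larger than `R` are all put into the family; this is
harmless, since a cube strictly larger than its child containing `R` has another child, of
comparable measure. In both cases each cube of the family has a large part outside the smaller
ones, which gives the packing condition (`DyadicSystem.tsum_measure_le`).

The adjacent systems (`IsSpaceOfHomogeneousType.exists_isAdjacent`) are built from nets. A maximal
`δ ^ (k + 1)`-separated set is split into boundedly many `δ ^ k`-separated ones, which are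
extended to maximal ones (`IsSpaceOfHomogeneousType.exists_nets`); each of the resulting nets
provides the centers of generation `k` of one system. Given a net for each generation, assign to
each net point a parent in the previous generation. Every point `x` is a limit of descendants of
some net point of each generation, and one can select such net points compatibly with parents and
in a Borel way (`IsParent.exists_isSelection`); the cubes are the fibers of these selections
(`IsNetFamily.exists_dyadicSystem`).
-/

/-! ### Quasi-metric balls, doubling and nets -/

namespace HomogType

section Geometry

variable {X : Type u} {d : X → X → ℝ} {A₀ : ℝ}

theorem IsQuasiMetric.pos (h : IsQuasiMetric d A₀) : 0 < A₀ := one_pos.trans_le h.one_le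

theorem IsQuasiMetric.dist_self (h : IsQuasiMetric d A₀) (x : X) : d x x = 0 :=
  (h.eq_zero_iff x x).2 rfl

theorem IsQuasiMetric.mem_qball_self (h : IsQuasiMetric d A₀) {x : X} {r : ℝ} (hr : 0 < r) :
    x ∈ qball d x r :=
  (h.dist_self x).trans_lt hr

theorem IsQuasiMetric.dist_lt (h : IsQuasiMetric d A₀) {x y z : X} {r s t : ℝ}
    (hxy : d x y < r) (hyz : d y z ≤ s) (ht : A₀ * (r + s) ≤ t) : d x z < t :=
  calc d x z ≤ A₀ * (d x y + d y z) := h.triangle x z y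
    _ < A₀ * (r + s) := mul_lt_mul_of_pos_left (by linarith) h.pos
    _ ≤ t := ht

theorem IsQuasiMetric.qball_subset (h : IsQuasiMetric d A₀) {x y : X} {r s t : ℝ}
    (hxy : d x y ≤ r) (ht : A₀ * (r + s) ≤ t) : qball d y s ⊆ qball d x t := by
  intro z hz
  have hz : d y z < s := hz
  change d x z < t
  rw [h.symm] at hz hxy ⊢
  exact h.dist_lt hz hxy (by rwa [add_comm])

theorem qball_mono {x : X} {r s : ℝ} (h : r ≤ s) : qball d x r ⊆ qball d x s :=
  fun _ hy => lt_of_lt_of_le hy h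

/-- Distinct points of `Y` are at distance at least `s`. -/
def IsSep (d : X → X → ℝ) (s : ℝ) (Y : Set X) : Prop := Y.Pairwise fun x y => s ≤ d x y

theorem IsSep.mono {s : ℝ} {Y Z : Set X} (h : IsSep d s Y) (hZ : Z ⊆ Y) : IsSep d s Z :=
  Set.Pairwise.mono hZ h

/-- Zorn's lemma: a separated subset of `A` extends to a maximal one, which is then a net. -/
theorem IsQuasiMetric.exists_net (h : IsQuasiMetric d A₀) {s : ℝ} (hs : 0 < s) {Y A : Set X}
    (hYA : Y ⊆ A) (hY : IsSep d s Y) :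
    ∃ N, Y ⊆ N ∧ N ⊆ A ∧ IsSep d s N ∧ ∀ x ∈ A, ∃ z ∈ N, d x z < s := by
  obtain ⟨N, hYN, hN⟩ := zorn_subset_nonempty {N : Set X | N ⊆ A ∧ IsSep d s N}
    (fun c hc hcc _ => ⟨⋃₀ c, ⟨Set.sUnion_subset fun N hN => (hc hN).1,
      (Set.pairwise_sUnion hcc.directedOn).2 fun N hN => (hc hN).2⟩,
      fun N hN => Set.subset_sUnion_of_mem hN⟩) Y ⟨hYA, hY⟩
  refine ⟨N, hYN, hN.prop.1, hN.prop.2, fun x hx => ?_⟩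
  by_contra! hcon
  have hmem : x ∈ N := by
    refine hN.le_of_ge (y := insert x N) ⟨Set.insert_subset hx hN.prop.1, ?_⟩
      (Set.subset_insert x N) (Set.mem_insert x N)
    refine hN.prop.2.insert fun y hy _ => ⟨hcon y hy, ?_⟩
    rw [h.symm]
    exact hcon y hy
  have := hcon x hmem
  rw [h.dist_self] at this
  linarith

/-- A compact set for the quasi-metric topology is contained in a ball. Balls need not be open,
but the points having a small ball inside a given ball form an open set. -/
theorem IsQuasiMetric.exists_subset_qball (h : IsQuasiMetric d A₀) {K : Set X}
    (hK : @IsCompact X (quasiTopology d) K) (x₀ : X) : ∃ n : ℕ, K ⊆ qball d x₀ n := by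
  let := quasiTopology d
  let U : ℕ → Set X := fun n => {y | ∃ ε > 0, qball d y ε ⊆ qball d x₀ n}
  have hA := h.pos
  have hUo : ∀ n, IsOpen (U n) := by
    rintro n y ⟨ε, hε, hy⟩
    refine ⟨ε / (2 * A₀), by positivity, fun z hz => ⟨ε / (2 * A₀), by positivity, ?_⟩⟩
    refine (h.qball_subset (le_of_lt hz) ?_).trans hy
    apply le_of_eq
    field_simp
    ring
  have hUmono : Monotone U := fun m n hmn y ⟨ε, hε, hy⟩ =>
    ⟨ε, hε, hy.trans (qball_mono (by exact_mod_cast hmn))⟩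
  obtain ⟨n, hn⟩ := hK.elim_directed_cover U hUo (fun y _ => by
    obtain ⟨n, hn⟩ := exists_nat_ge (A₀ * (d x₀ y + 1))
    exact Set.mem_iUnion.2 ⟨n, 1, one_pos, h.qball_subset le_rfl hn⟩) hUmono.directed_le
  exact ⟨n, fun y hy => by
    obtain ⟨ε, hε, hy⟩ := hn hy
    exact hy (h.mem_qball_self hε)⟩

end Geometry

section Doubling

variable {X : Type u} [MeasurableSpace X] {d : X → X → ℝ} {μ : Measure X} {A₀ : ℝ} {Cμ : ℝ≥0}

/-- An integer bound for the ratio of the measures of concentric balls whose radii have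
ratio `a`. -/
noncomputable def ballRatio (Cμ : ℝ≥0) (a : ℝ) : ℕ := ⌈Cμ ^ ⌈a⌉₊⌉₊

theorem IsSpaceOfHomogeneousType.measure_qball_mul_le
    (h : IsSpaceOfHomogeneousType d μ A₀ Cμ) (x : X) {r : ℝ} (hr : 0 < r) (a : ℝ) :
    μ (qball d x (a * r)) ≤ ballRatio Cμ a * μ (qball d x r) := by
  have key : ∀ n : ℕ, μ (qball d x (2 ^ n * r)) ≤ (Cμ : ℝ≥0∞) ^ n * μ (qball d x r) := by
    intro n
    induction n with
    | zero => simp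
    | succ n ih =>
      calc μ (qball d x (2 ^ (n + 1) * r)) = μ (qball d x (2 * (2 ^ n * r))) := by ring_nf
        _ ≤ Cμ * μ (qball d x (2 ^ n * r)) := h.doubling x _ (by positivity)
        _ ≤ Cμ * ((Cμ : ℝ≥0∞) ^ n * μ (qball d x r)) := by gcongr
        _ = _ := by ring
  have ha : a ≤ 2 ^ ⌈a⌉₊ :=
    (Nat.le_ceil a).trans (by exact_mod_cast (Nat.lt_two_pow_self (n := ⌈a⌉₊)).le)
  refine (measure_mono (qball_mono (mul_le_mul_of_nonneg_right ha hr.le))).trans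
    ((key _).trans ?_)
  gcongr
  have : Cμ ^ ⌈a⌉₊ ≤ (ballRatio Cμ a : ℝ≥0) := Nat.le_ceil _
  exact_mod_cast this

theorem IsSpaceOfHomogeneousType.measure_qball_pos
    (h : IsSpaceOfHomogeneousType d μ A₀ Cμ) (x : X) {r : ℝ} (hr : 0 < r) :
    0 < μ (qball d x r) := by
  rw [pos_iff_ne_zero]
  intro h0
  have hn : ∀ n : ℕ, μ (qball d x n) = 0 := fun n => by
    have := h.measure_qball_mul_le x hr (n / r)
    rw [div_mul_cancel₀ _ hr.ne', h0, mul_zero] at this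
    exact le_antisymm this bot_le
  have hU : ⋃ n : ℕ, qball d x n = Set.univ := Set.eq_univ_of_forall fun y => by
    obtain ⟨n, hn⟩ := exists_nat_gt (d x y)
    exact Set.mem_iUnion.2 ⟨n, hn⟩
  have := h.measure_univ
  rw [← hU, measure_iUnion_null hn] at this
  exact ENNReal.zero_ne_top this

/-- Bound for the number of points of an `s`-separated set in a ball of radius `ρ * s`. -/
noncomputable def sepCard (A₀ : ℝ) (Cμ : ℝ≥0) (ρ : ℝ) : ℕ :=
  ballRatio Cμ (A₀ * (ρ * (2 * A₀) + A₀ * (ρ * (2 * A₀) + 1)))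

/-- Geometric doubling: the balls of radius `s / (2 * A₀)` about the points are disjoint, and
each of them has a fixed proportion of the measure of a ball containing all of them. -/
theorem IsSpaceOfHomogeneousType.encard_le
    (h : IsSpaceOfHomogeneousType d μ A₀ Cμ) {s ρ : ℝ} (hs : 0 < s) (hρ : 0 < ρ) {Y : Set X}
    (hY : IsSep d s Y) {x : X} (hYx : Y ⊆ qball d x (ρ * s)) :
    Y.encard ≤ sepCard A₀ Cμ ρ := by
  have hq := h.quasiMetric
  have hA := hq.pos
  set u := s / (2 * A₀) with hu
  have hu0 : 0 < u := by positivity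
  have hsu : s = 2 * A₀ * u := by rw [hu]; field_simp
  set R := A₀ * (ρ * s + u) with hR
  have hR0 : 0 < R := by positivity
  have h1 : ∀ z ∈ Y, qball d z u ⊆ qball d x R := fun z hz =>
    hq.qball_subset (le_of_lt (hYx hz)) le_rfl
  have h2 : ∀ z ∈ Y, μ (qball d x R) ≤ sepCard A₀ Cμ ρ * μ (qball d z u) := fun z hz => by
    refine (measure_mono (hq.qball_subset (x := z) (r := ρ * s) ?_ le_rfl)).trans ?_
    · rw [hq.symm]
      exact le_of_lt (hYx hz)
    · have hRu : A₀ * (ρ * s + R) =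
          A₀ * (ρ * (2 * A₀) + A₀ * (ρ * (2 * A₀) + 1)) * u := by
        rw [hR, hsu]
        ring
      rw [hRu]
      exact h.measure_qball_mul_le z hu0 _
  have hdisj : Y.PairwiseDisjoint fun z => qball d z u := by
    intro z hz w hw hzw
    refine Set.disjoint_left.2 fun y hy hy' => ?_
    have hy' : d w y < u := hy'
    rw [hq.symm] at hy'
    have := hq.dist_lt hy hy'.le (t := s) (by rw [hsu]; apply le_of_eq; ring)
    exact (hY hz hw hzw).not_gt this
  by_contra! hcon
  obtain ⟨F, hFY, hF⟩ := Set.exists_subset_encard_eq (Order.add_one_le_of_lt hcon)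
  have hFfin : F.Finite := Set.finite_of_encard_eq_coe (k := sepCard A₀ Cμ ρ + 1)
    (by rw [hF]; norm_cast)
  lift F to Finset X using hFfin
  have hcard : F.card = sepCard A₀ Cμ ρ + 1 := by
    rw [Set.encard_coe_eq_coe_finsetCard] at hF
    exact_mod_cast hF
  have hBpos : μ (qball d x R) ≠ 0 := (h.measure_qball_pos x hR0).ne'
  have hBtop : μ (qball d x R) ≠ ∞ := (h.qball_lt_top x R hR0).ne
  have hsum : ∑ z ∈ F, μ (qball d z u) ≤ μ (qball d x R) := by
    rw [← measure_biUnion_finset (hdisj.subset hFY) fun z _ => h.measurableSet_qball z u]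
    exact measure_mono (Set.iUnion₂_subset fun z hz => h1 z (hFY hz))
  have hle : (F.card : ℝ≥0∞) * μ (qball d x R) ≤ sepCard A₀ Cμ ρ * μ (qball d x R) :=
    calc (F.card : ℝ≥0∞) * μ (qball d x R) = ∑ z ∈ F, μ (qball d x R) := by simp
      _ ≤ ∑ z ∈ F, sepCard A₀ Cμ ρ * μ (qball d z u) :=
        Finset.sum_le_sum fun z hz => h2 z (hFY hz)
      _ = sepCard A₀ Cμ ρ * ∑ z ∈ F, μ (qball d z u) := by rw [Finset.mul_sum]
      _ ≤ _ := by gcongr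
  rw [ENNReal.mul_le_mul_iff_left hBpos hBtop, hcard] at hle
  have : sepCard A₀ Cμ ρ + 1 ≤ sepCard A₀ Cμ ρ := by exact_mod_cast hle
  omega

theorem IsSpaceOfHomogeneousType.countable_of_isSep
    (h : IsSpaceOfHomogeneousType d μ A₀ Cμ) {s : ℝ} (hs : 0 < s) {Y : Set X}
    (hY : IsSep d s Y) : Y.Countable := by
  rcases isEmpty_or_nonempty X with hX | ⟨⟨x₀⟩⟩
  · exact Set.to_countable Y
  have hU : Y ⊆ ⋃ n : ℕ, Y ∩ qball d x₀ (n + 1) := fun y hy => by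
    obtain ⟨n, hn⟩ := exists_nat_gt (d x₀ y)
    exact Set.mem_iUnion.2 ⟨n, hy, show d x₀ y < n + 1 by linarith⟩
  refine (Set.countable_iUnion fun n => ?_).mono hU
  have := h.encard_le (ρ := (n + 1) / s) hs (by positivity) (hY.mono Set.inter_subset_left)
    (Y := Y ∩ qball d x₀ (n + 1)) (x := x₀)
    (by rw [div_mul_cancel₀ _ hs.ne']; exact Set.inter_subset_right)
  exact (Set.finite_of_encard_le_coe this).countable

/-- A fine net is covered by boundedly many coarse separated sets, each of which extends to a
coarse net. The coarse sets are chosen greedily, each one maximal among the points not used so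
far: a point left over has a neighbor in each of them, so there are few of them. -/
theorem IsSpaceOfHomogeneousType.exists_nets
    (h : IsSpaceOfHomogeneousType d μ A₀ Cμ) {s ρ : ℝ} (hs : 0 < s) (hρ : 0 < ρ) :
    ∃ N : Fin (sepCard A₀ Cμ ρ + 1) → Set X,
      (∀ t, IsSep d (ρ * s) (N t) ∧ ∀ x, ∃ z ∈ N t, d x z < ρ * s) ∧
      ∀ x, ∃ t, ∃ z ∈ N t, d x z < s := by
  have hq := h.quasiMetric
  have hρs : 0 < ρ * s := by positivity
  obtain ⟨Y, -, -, hY, hYnet⟩ := hq.exists_net hs (Set.empty_subset Set.univ)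
    (Set.pairwise_empty _)
  have hstep : ∀ V : Set X, ∃ N ⊆ V, IsSep d (ρ * s) N ∧ ∀ x ∈ V, ∃ z ∈ N, d x z < ρ * s :=
    fun V => by
      obtain ⟨N, -, hN⟩ := hq.exists_net hρs (Set.empty_subset V) (Set.pairwise_empty _)
      exact ⟨N, hN⟩
  choose G hGV hGsep hGnet using hstep
  -- `V n` is what remains of `Y` after `n` steps.
  let V : ℕ → Set X := fun n => Nat.rec Y (fun _ W => W \ G W) n
  have hVs : ∀ n, V (n + 1) = V n \ G (V n) := fun n => rfl
  have hVanti : Antitone V := antitone_nat_of_succ_le fun n => by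
    rw [hVs]; exact Set.sdiff_subset
  have hVY : ∀ n, V n ⊆ Y := fun n => hVanti (Nat.zero_le n)
  have hempty : V (sepCard A₀ Cμ ρ + 1) = ∅ := by
    by_contra! hne
    obtain ⟨y, hy⟩ := hne
    have hmem : ∀ i : Fin (sepCard A₀ Cμ ρ + 1), ∃ z ∈ G (V i), d y z < ρ * s := fun i =>
      hGnet _ y (hVanti i.2.le hy)
    choose g hg hgd using hmem
    have hlt : ∀ i j : Fin (sepCard A₀ Cμ ρ + 1), i < j → g i ≠ g j := fun i j hij he => by
      have h1 : g j ∈ V (i + 1) := hVanti (Nat.succ_le_of_lt hij) (hGV _ (hg j))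
      rw [hVs] at h1
      exact h1.2 (he ▸ hg i)
    have hinj : Function.Injective g := fun i j he => by
      rcases lt_trichotomy i j with hij | hij | hij
      · exact (hlt i j hij he).elim
      · exact hij
      · exact (hlt j i hij he.symm).elim
    have hrY : Set.range g ⊆ Y := by
      rintro _ ⟨i, rfl⟩
      exact hVY _ (hGV _ (hg i))
    have hle := h.encard_le hs hρ (hY.mono hrY) (x := y) (by rintro _ ⟨i, rfl⟩; exact hgd i)
    rw [← Set.image_univ, hinj.encard_image, Set.encard_univ] at hle
    simp only [ENat.card_eq_coe_fintype_card, Fintype.card_fin] at hle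
    have : sepCard A₀ Cμ ρ + 1 ≤ sepCard A₀ Cμ ρ := by exact_mod_cast hle
    omega
  have hcov : ∀ n, ∀ y ∈ Y, y ∉ V n → ∃ i < n, y ∈ G (V i) := by
    intro n y hy
    induction n with
    | zero => exact fun hn => (hn hy).elim
    | succ n ih =>
      intro hn
      rcases Classical.em (y ∈ V n) with hyn | hyn
      · exact ⟨n, n.lt_succ_self, Classical.not_not.1 fun hG => hn ⟨hyn, hG⟩⟩
      · obtain ⟨i, hi, hyi⟩ := ih hyn
        exact ⟨i, hi.trans n.lt_succ_self, hyi⟩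
  have hext : ∀ i : Fin (sepCard A₀ Cμ ρ + 1), ∃ N, G (V i) ⊆ N ∧ IsSep d (ρ * s) N ∧
      ∀ x, ∃ z ∈ N, d x z < ρ * s := fun i => by
    obtain ⟨N, h1, -, h2, h3⟩ := hq.exists_net hρs (Set.subset_univ _) (hGsep (V i))
    exact ⟨N, h1, h2, fun x => h3 x (Set.mem_univ x)⟩
  choose N hGN hN using hext
  refine ⟨N, hN, fun x => ?_⟩
  obtain ⟨y, hy, hxy⟩ := hYnet x (Set.mem_univ x)
  obtain ⟨i, hi, hyi⟩ := hcov (sepCard A₀ Cμ ρ + 1) y hy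
    (by rw [hempty]; exact Set.notMem_empty y)
  exact ⟨⟨i, hi⟩, y, hGN _ hyi, hxy⟩

end Doubling

end HomogType

/-! ### Ancestors and Borel selections of net points -/

namespace HomogType

section Ancestors

variable {X : Type u} {d : X → X → ℝ} {A₀ δ : ℝ} {N : ℤ → Set X} {par : ℤ → X → X}

/-- For every `k`, the set `N k` is a maximal `δ ^ k`-separated set. -/
structure IsNetFamily (d : X → X → ℝ) (δ : ℝ) (N : ℤ → Set X) : Prop where
  sep : ∀ k, IsSep d (δ ^ k) (N k)
  exists_near : ∀ k x, ∃ z ∈ N k, d x z < δ ^ k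

/-- `par k w` is a point of the net `N k` close to `w`. If some point of the net is very close
to `w`, then `par k w` is that point. -/
structure IsParent (d : X → X → ℝ) (A₀ δ : ℝ) (N : ℤ → Set X) (par : ℤ → X → X) : Prop where
  mem : ∀ k w, par k w ∈ N k
  dist_lt : ∀ k w, d w (par k w) < δ ^ k
  eq_of_dist_lt : ∀ k w, ∀ z ∈ N k, d w z < δ ^ k / (2 * A₀) → par k w = z

theorem IsNetFamily.exists_isParent (hN : IsNetFamily d δ N) (hq : IsQuasiMetric d A₀)
    (hδ : 0 < δ) : ∃ par, IsParent d A₀ δ N par := by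
  have hA := hq.pos
  have key : ∀ k w, ∃ p ∈ N k, d w p < δ ^ k ∧
      ∀ z ∈ N k, d w z < δ ^ k / (2 * A₀) → p = z := by
    intro k w
    have hk : 0 < δ ^ k := zpow_pos hδ k
    have hdiv : δ ^ k / (2 * A₀) ≤ δ ^ k / 2 :=
      div_le_div_of_nonneg_left hk.le two_pos (by linarith [hq.one_le])
    by_cases hex : ∃ p ∈ N k, d w p < δ ^ k / (2 * A₀)
    · obtain ⟨p, hp, hwp⟩ := hex
      refine ⟨p, hp, by linarith, fun z hz hwz => ?_⟩
      by_contra hne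
      rw [hq.symm] at hwp
      have := hq.dist_lt hwp hwz.le (t := δ ^ k) (by apply le_of_eq; field_simp; ring)
      exact (hN.sep k hp hz hne).not_gt this
    · obtain ⟨p, hp, hwp⟩ := hN.exists_near k w
      exact ⟨p, hp, hwp, fun z hz hwz => (hex ⟨z, hz, hwz⟩).elim⟩
  choose par h1 h2 h3 using key
  exact ⟨par, h1, h2, h3⟩

/-- The ancestor in generation `k` of a point of generation `k + m`. -/
def anc (par : ℤ → X → X) (k : ℤ) : ℕ → X → X
  | 0, w => w
  | m + 1, w => anc par k m (par (k + m) w)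

theorem anc_succ (par : ℤ → X → X) (k : ℤ) (m : ℕ) (w : X) :
    anc par k (m + 1) w = par k (anc par (k + 1) m w) := by
  induction m generalizing w with
  | zero => simp [anc]
  | succ m ih =>
    rw [anc, ih, anc]
    congr 3
    push_cast
    ring

/-- The point `x` is a limit of descendants of the point `z` of generation `k`. -/
def IsLimitOf (d : X → X → ℝ) (A₀ δ : ℝ) (N : ℤ → Set X) (par : ℤ → X → X) (k : ℤ)
    (x z : X) : Prop :=
  ∀ m : ℕ, ∃ w ∈ N (k + m), d x w < 2 * A₀ * δ ^ (k + m) ∧ anc par k m w = z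

theorem IsParent.dist_par_lt (hp : IsParent d A₀ δ N par) (hq : IsQuasiMetric d A₀)
    (hδ : 0 < δ) (hδA : 2 * A₀ * δ ≤ 1) {k : ℤ} {x w : X}
    (hw : d x w < 2 * A₀ * δ ^ (k + 1)) : d x (par k w) < 2 * A₀ * δ ^ k := by
  have hk : 0 < δ ^ k := zpow_pos hδ k
  refine hq.dist_lt hw (hp.dist_lt k w).le ?_
  rw [zpow_add_one₀ hδ.ne']
  nlinarith [mul_le_mul_of_nonneg_left hδA (mul_pos hq.pos hk).le]

theorem IsLimitOf.dist_lt {k : ℤ} {x z : X} (h : IsLimitOf d A₀ δ N par k x z) :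
    d x z < 2 * A₀ * δ ^ k := by
  obtain ⟨w, -, hw, rfl⟩ := h 0
  simpa [anc] using hw

theorem IsLimitOf.isLimitOf_par (hp : IsParent d A₀ δ N par) (hq : IsQuasiMetric d A₀)
    (hδ : 0 < δ) (hδA : 2 * A₀ * δ ≤ 1) {k : ℤ} {x z : X}
    (h : IsLimitOf d A₀ δ N par (k + 1) x z) : IsLimitOf d A₀ δ N par k x (par k z) := by
  intro m
  rcases m with _ | m
  · refine ⟨par k z, by simpa using hp.mem k z, ?_, rfl⟩
    simpa using hp.dist_par_lt hq hδ hδA h.dist_lt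
  · obtain ⟨w, hw, hxw, hwz⟩ := h m
    have he : k + ((m + 1 : ℕ) : ℤ) = k + 1 + m := by push_cast; ring
    exact ⟨w, by rwa [he], by rwa [he], by rw [anc_succ, hwz]⟩

/-- The condition in `IsLimitOf` for `n` implies the one for every `m ≤ n`. -/
theorem IsParent.exists_anc_of_le (hp : IsParent d A₀ δ N par) (hq : IsQuasiMetric d A₀)
    (hδ : 0 < δ) (hδA : 2 * A₀ * δ ≤ 1) {k : ℤ} {x z : X} {m n : ℕ} (hmn : m ≤ n)
    (h : ∃ w ∈ N (k + n), d x w < 2 * A₀ * δ ^ (k + n) ∧ anc par k n w = z) :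
    ∃ w ∈ N (k + m), d x w < 2 * A₀ * δ ^ (k + m) ∧ anc par k m w = z := by
  induction n, hmn using Nat.le_induction with
  | base => exact h
  | succ n _ ih =>
    obtain ⟨w, -, hxw, hwz⟩ := h
    have he : k + ((n + 1 : ℕ) : ℤ) = k + n + 1 := by push_cast; ring
    rw [he] at hxw
    exact ih ⟨par (k + n) w, hp.mem _ w, hp.dist_par_lt hq hδ hδA hxw, hwz⟩

/-- A pigeonhole argument: there are finitely many candidates near `x`, and a candidate that
works for arbitrarily large `m` works for all `m`. -/
theorem IsParent.exists_isLimitOf (hp : IsParent d A₀ δ N par) (hq : IsQuasiMetric d A₀)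
    (hδ : 0 < δ) (hδA : 2 * A₀ * δ ≤ 1) {k : ℤ} {x : X}
    (hfin : {z ∈ N k | d x z < 2 * A₀ * δ ^ k}.Finite) {p : X → Prop}
    (hpx : ∀ m : ℕ, ∃ w ∈ N (k + m), d x w < 2 * A₀ * δ ^ (k + m) ∧ p (anc par k m w)) :
    ∃ z ∈ N k, p z ∧ IsLimitOf d A₀ δ N par k x z := by
  by_contra! hcon
  have hbad : ∀ z ∈ {z ∈ N k | d x z < 2 * A₀ * δ ^ k}, ∃ m : ℕ, p z →
      ¬ ∃ w ∈ N (k + m), d x w < 2 * A₀ * δ ^ (k + m) ∧ anc par k m w = z := by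
    intro z hz
    by_cases hpz : p z
    · have := hcon z hz.1 hpz
      rw [IsLimitOf, not_forall] at this
      exact this.imp fun _ h _ => h
    · exact ⟨0, fun h => (hpz h).elim⟩
  choose! g hg using hbad
  obtain ⟨n, hn⟩ := (hfin.image g).bddAbove
  obtain ⟨w, hw, hxw, hpw⟩ := hpx n
  have h0 := hp.exists_anc_of_le hq hδ hδA (Nat.zero_le n) ⟨w, hw, hxw, rfl⟩
  obtain ⟨v, hv, hxv, hvw⟩ := h0
  simp only [anc, Nat.cast_zero, add_zero] at hv hxv hvw
  rw [← hvw] at hpw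
  have hvm : v ∈ {z ∈ N k | d x z < 2 * A₀ * δ ^ k} := ⟨hv, hxv⟩
  exact hg v hvm hpw (hp.exists_anc_of_le hq hδ hδA (hn ⟨v, hvm, rfl⟩) ⟨w, hw, hxw, hvw.symm⟩)

/-- The set of limits of descendants of `z` is closed. -/
theorem IsParent.isOpen_compl_isLimitOf (hp : IsParent d A₀ δ N par) (hq : IsQuasiMetric d A₀)
    (hδ : 0 < δ) (hδA : 4 * A₀ ^ 2 * δ ≤ 1) (k : ℤ) (z : X) :
    IsOpen[quasiTopology d] {x | IsLimitOf d A₀ δ N par k x z}ᶜ := by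
  intro x hx
  have hA := hq.pos
  have hδA' : 2 * A₀ * δ ≤ 1 := by
    nlinarith [mul_le_mul_of_nonneg_left hq.one_le (mul_pos hA hδ).le, mul_pos hA hδ]
  have hx : ¬ IsLimitOf d A₀ δ N par k x z := hx
  rw [IsLimitOf, not_forall] at hx
  obtain ⟨m, hm⟩ := hx
  have he : 0 < δ ^ (k + m + 1) := zpow_pos hδ _
  refine ⟨δ ^ (k + m + 1) / (2 * A₀), by positivity, fun y hy hyz => hm ?_⟩
  obtain ⟨w, hw, hyw, hwz⟩ := hyz (m + 2)
  have he1 : k + ((m + 1 : ℕ) : ℤ) = k + m + 1 := by push_cast; ring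
  have he2 : k + ((m + 2 : ℕ) : ℤ) = k + m + 1 + 1 := by push_cast; ring
  rw [he2, zpow_add_one₀ hδ.ne'] at hyw
  set e := δ ^ (k + m + 1) with hedef
  refine ⟨par (k + m) (par (k + m + 1) w), hp.mem _ _, ?_, ?_⟩
  · refine hp.dist_par_lt hq hδ hδA' ?_
    have h1 : d x w < A₀ * (e / (2 * A₀) + 2 * A₀ * (e * δ)) := hq.dist_lt hy hyw.le le_rfl
    have h2 : A₀ * (e / (2 * A₀) + 2 * A₀ * (e * δ)) ≤ e := by
      have : A₀ * (e / (2 * A₀) + 2 * A₀ * (e * δ)) = e / 2 + (4 * A₀ ^ 2 * δ) * e / 2 := by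
        field_simp
        ring
      rw [this]
      nlinarith
    exact hq.dist_lt (h1.trans_le h2) (hp.dist_lt (k + m + 1) w).le (by rw [← hedef]; linarith)
  · rw [← hwz, anc, anc, he1]

end Ancestors

section Selection

variable {X : Type u} {d : X → X → ℝ} {A₀ δ : ℝ} {N : ℤ → Set X} {par : ℤ → X → X}

theorem exists_measurable_selection [MeasurableSpace X] {N : Set X} (hN : N.Countable)
    {p : X → X → Prop} (hp : ∀ z ∈ N, MeasurableSet {x | p x z}) (hex : ∀ x, ∃ z ∈ N, p x z) :
    ∃ s : X → X, (∀ x, s x ∈ N ∧ p x (s x)) ∧ ∀ z ∈ N, MeasurableSet (s ⁻¹' {z}) := by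
  classical
  obtain ⟨g, hg⟩ := Set.countable_iff_exists_injOn.1 hN
  have hmin : ∀ x, ∃ z ∈ N, p x z ∧ ∀ z' ∈ N, p x z' → g z ≤ g z' := by
    intro x
    have hex' : ∃ n, ∃ z ∈ N, p x z ∧ g z = n := by
      obtain ⟨z, hz, hxz⟩ := hex x
      exact ⟨g z, z, hz, hxz, rfl⟩
    obtain ⟨z, hz, hxz, hgz⟩ := Nat.find_spec hex'
    exact ⟨z, hz, hxz, fun z' hz' hxz' => hgz ▸ Nat.find_min' hex' ⟨z', hz', hxz', rfl⟩⟩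
  choose s hs hps hsmin using hmin
  refine ⟨s, fun x => ⟨hs x, hps x⟩, fun z hz => ?_⟩
  have : s ⁻¹' {z} = {x | p x z} ∩ ⋂ z' ∈ {z' ∈ N | g z' < g z}, {x | p x z'}ᶜ := by
    ext x
    simp only [Set.mem_preimage, Set.mem_singleton_iff, Set.mem_inter_iff, Set.mem_ofPred_eq,
      Set.mem_iInter, Set.mem_compl_iff]
    constructor
    · rintro rfl
      exact ⟨hps x, fun z' hz' hxz' => (hsmin x z' hz'.1 hxz').not_gt hz'.2⟩
    · rintro ⟨hxz, hlt⟩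
      exact hg (hs x) hz (le_antisymm (hsmin x z hz hxz)
        (not_lt.1 fun hl => hlt (s x) ⟨hs x, hl⟩ (hps x)))
  rw [this]
  exact (hp z hz).inter (MeasurableSet.biInter (hN.mono (Set.sep_subset _ _))
    fun z' hz' => (hp z' hz'.1).compl)

/-- `s` selects for each point `x` a point of generation `k` having `x` as a limit of its
descendants, with measurable fibers. -/
def IsSelection [MeasurableSpace X] (d : X → X → ℝ) (A₀ δ : ℝ) (N : ℤ → Set X)
    (par : ℤ → X → X) (k : ℤ) (s : X → X) : Prop :=
  (∀ x, s x ∈ N k ∧ IsLimitOf d A₀ δ N par k x (s x)) ∧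
    ∀ z ∈ N k, MeasurableSet (s ⁻¹' {z})

theorem IsSelection.par_comp [MeasurableSpace X] (hp : IsParent d A₀ δ N par)
    (hq : IsQuasiMetric d A₀) (hδ : 0 < δ) (hδA : 2 * A₀ * δ ≤ 1) {k : ℤ}
    (hN : (N (k + 1)).Countable) {s : X → X}
    (hs : IsSelection d A₀ δ N par (k + 1) s) :
    IsSelection d A₀ δ N par k (fun x => par k (s x)) := by
  refine ⟨fun x => ⟨hp.mem k _, (hs.1 x).2.isLimitOf_par hp hq hδ hδA⟩, fun z _ => ?_⟩
  have : (fun x => par k (s x)) ⁻¹' {z} = ⋃ w ∈ {w ∈ N (k + 1) | par k w = z}, s ⁻¹' {w} := by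
    ext x
    simp only [Set.mem_preimage, Set.mem_singleton_iff, Set.mem_ofPred_eq, Set.mem_iUnion,
      exists_prop]
    exact ⟨fun h => ⟨s x, ⟨(hs.1 x).1, h⟩, rfl⟩, fun ⟨w, hw, hwx⟩ => hwx ▸ hw.2⟩
  rw [this]
  exact MeasurableSet.biUnion (hN.mono (Set.sep_subset _ _)) fun w hw => hs.2 w hw.1

/-- Compatible selections for all generations. They are chosen one after the other from
generation `0` on, and obtained by taking parents before generation `0`. -/
theorem IsParent.exists_isSelection [MeasurableSpace X] (hp : IsParent d A₀ δ N par)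
    (hq : IsQuasiMetric d A₀) (hN : IsNetFamily d δ N) (hδ : 0 < δ) (hδA : 2 * A₀ * δ ≤ 1)
    (hcount : ∀ k, (N k).Countable)
    (hfin : ∀ k x, {z ∈ N k | d x z < 2 * A₀ * δ ^ k}.Finite)
    (hmeas : ∀ k z, MeasurableSet {x | IsLimitOf d A₀ δ N par k x z}) :
    ∃ π : ℤ → X → X, (∀ k, IsSelection d A₀ δ N par k (π k)) ∧
      ∀ k x, par k (π (k + 1) x) = π k x := by
  have hA := hq.pos
  have hzero : ∃ s, IsSelection d A₀ δ N par 0 s := by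
    refine exists_measurable_selection (hcount 0) (fun z _ => hmeas 0 z) fun x => ?_
    obtain ⟨z, hz, -, hxz⟩ := hp.exists_isLimitOf hq hδ hδA (hfin 0 x) (p := fun _ => True)
      fun m => by
        obtain ⟨w, hw, hxw⟩ := hN.exists_near (0 + m) x
        have : 0 < δ ^ ((0 : ℤ) + m) := zpow_pos hδ _
        exact ⟨w, hw, by nlinarith [hq.one_le], trivial⟩
    exact ⟨z, hz, hxz⟩
  have hstep : ∀ (n : ℕ) (s : X → X), IsSelection d A₀ δ N par n s →
      ∃ s', IsSelection d A₀ δ N par ((n + 1 : ℕ) : ℤ) s' ∧ ∀ x, par n (s' x) = s x := by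
    intro n s hs
    push_cast
    obtain ⟨s', hs', hmeas'⟩ := exists_measurable_selection (hcount (n + 1))
      (p := fun x z => par n z = s x ∧ IsLimitOf d A₀ δ N par (n + 1) x z)
      (fun z _ => by
        have h1 : {x | par n z = s x} = s ⁻¹' {par n z} := Set.ext fun x => eq_comm
        exact (h1 ▸ hs.2 (par n z) (hp.mem n z) : MeasurableSet {x | par n z = s x}).inter
          (hmeas (n + 1) z))
      (fun x => by
        refine hp.exists_isLimitOf hq hδ hδA (hfin _ x) (p := fun z => par n z = s x) fun m => ?_
        obtain ⟨w, hw, hxw, hwx⟩ := (hs.1 x).2 (m + 1)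
        have he : (n : ℤ) + ((m + 1 : ℕ) : ℤ) = n + 1 + m := by push_cast; ring
        rw [he] at hw hxw
        exact ⟨w, hw, hxw, (anc_succ par n m w).symm.trans hwx⟩)
    exact ⟨s', ⟨fun x => ⟨(hs' x).1, (hs' x).2.2⟩, hmeas'⟩, fun x => (hs' x).2.1⟩
  choose! next hnext hpar using hstep
  obtain ⟨s₀, hs₀⟩ := hzero
  let σ : ℕ → X → X := fun n => Nat.rec s₀ next n
  have hσ : ∀ n : ℕ, IsSelection d A₀ δ N par n (σ n) := fun n => by
    induction n with
    | zero => exact hs₀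
    | succ n ih => exact hnext n _ ih
  have hσpar : ∀ (n : ℕ) x, par n (σ (n + 1) x) = σ n x := fun n => hpar n _ (hσ n)
  let π : ℤ → X → X := fun k x => anc par k (-k).toNat (σ k.toNat x)
  have hπnat : ∀ n : ℕ, π n = σ n := fun n => by
    funext x
    simp [π, anc]
  have hπpar : ∀ k x, par k (π (k + 1) x) = π k x := by
    intro k x
    rcases le_or_gt 0 k with hk | hk
    · lift k to ℕ using hk
      have h1 := hπnat (k + 1)
      push_cast at h1
      rw [h1, hπnat, hσpar]
    · obtain ⟨m, rfl⟩ : ∃ m : ℕ, k = -(m + 1 : ℤ) := ⟨(-k - 1).toNat, by omega⟩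
      have h1 : (- -(m + 1 : ℤ)).toNat = m + 1 := by omega
      have h2 : (-(m + 1 : ℤ)).toNat = 0 := by omega
      have h3 : (-(-(m + 1 : ℤ) + 1)).toNat = m := by omega
      have h4 : (-(m + 1 : ℤ) + 1).toNat = 0 := by omega
      simp only [π]
      rw [h1, h2, h3, h4, anc_succ]
  refine ⟨π, fun k => ?_, hπpar⟩
  rcases le_or_gt 0 k with hk | hk
  · lift k to ℕ using hk
    exact hπnat k ▸ hσ k
  · have hneg : ∀ m : ℕ, IsSelection d A₀ δ N par (-(m : ℤ)) (π (-(m : ℤ))) := fun m => by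
      induction m with
      | zero => simpa using (hπnat 0 ▸ hσ 0 : IsSelection d A₀ δ N par (0 : ℕ) (π (0 : ℕ)))
      | succ m ih =>
        have he : -((m + 1 : ℕ) : ℤ) + 1 = -(m : ℤ) := by push_cast; ring
        have hc : (fun x => par (-((m + 1 : ℕ) : ℤ)) (π (-(m : ℤ)) x)) =
            π (-((m + 1 : ℕ) : ℤ)) := by
          funext x
          rw [← he, hπpar]
        rw [← hc]
        exact IsSelection.par_comp hp hq hδ hδA (hcount _) (he ▸ ih)
    have hk' : k = -(((-k).toNat : ℕ) : ℤ) := by omega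
    rw [hk']
    exact hneg _

end Selection

end HomogType

/-! ### Construction of adjacent dyadic systems -/

namespace HomogType

section Construction

variable {X : Type u} [MeasurableSpace X] {d : X → X → ℝ} {μ : Measure X} {A₀ δ : ℝ} {Cμ : ℝ≥0}

/-- The cubes are the fibers of the maps selecting for each point a nearby net point of each
generation. These maps are compatible with passing to parents, which makes the fibers nested. -/
theorem IsNetFamily.exists_dyadicSystem {N : ℤ → Set X} (hN : IsNetFamily d δ N)
    (h : IsSpaceOfHomogeneousType d μ A₀ Cμ) (hδ : 0 < δ) (hδA : 8 * A₀ ^ 3 * δ ≤ 1) :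
    ∃ D : DyadicSystem d δ (1 / (4 * A₀ ^ 2)) (4 * A₀ ^ 2) (sepCard A₀ Cμ (2 * A₀ / δ)),
      D.centers = N := by
  have hq := h.quasiMetric
  have hA := hq.pos
  have hA1 := hq.one_le
  have hδ2 : 4 * A₀ ^ 2 * δ ≤ 1 := by
    have : 0 ≤ 4 * A₀ ^ 2 * δ * (2 * A₀ - 1) :=
      mul_nonneg (by positivity) (by linarith)
    nlinarith
  have hδ1 : 2 * A₀ * δ ≤ 1 := by
    have : 0 ≤ 2 * A₀ * δ * (2 * A₀ - 1) := mul_nonneg (by positivity) (by linarith)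
    nlinarith
  have hδlt : δ < 1 := by nlinarith
  obtain ⟨par, hp⟩ := hN.exists_isParent hq hδ
  have hpos : ∀ k : ℤ, 0 < δ ^ k := fun k => zpow_pos hδ k
  have hcount : ∀ k, (N k).Countable := fun k => h.countable_of_isSep (hpos k) (hN.sep k)
  have hfin : ∀ k x, {z ∈ N k | d x z < 2 * A₀ * δ ^ k}.Finite := fun k x =>
    Set.finite_of_encard_le_coe (h.encard_le (hpos k) (ρ := 2 * A₀) (by positivity)
      ((hN.sep k).mono (Set.sep_subset _ _)) (x := x) fun z hz => hz.2)
  obtain ⟨π, hπ, hπpar⟩ := @IsParent.exists_isSelection X d A₀ δ N par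
    (@borel X (quasiTopology d)) hp hq hN hδ hδ1 hcount hfin fun k z => by
      let := quasiTopology d
      let := borel X
      have : BorelSpace X := ⟨rfl⟩
      exact (hp.isOpen_compl_isLimitOf hq hδ hδ2 k z).measurableSet.of_compl
  have hmem : ∀ k x, π k x ∈ N k := fun k x => ((hπ k).1 x).1
  have hdist : ∀ k x, d x (π k x) < 2 * A₀ * δ ^ k := fun k x => ((hπ k).1 x).2.dist_lt
  -- Points of one fiber have the same ancestors.
  have hanc : ∀ k l, k ≤ l → ∀ x y, π l x = π l y → π k x = π k y := by
    intro k l hkl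
    induction l, hkl using Int.leInduction with
    | base => exact fun _ _ hxy => hxy
    | succ l _ ih => exact fun x y hxy => ih x y (by rw [← hπpar, hxy, hπpar])
  have hball : ∀ k, ∀ z ∈ N k, ∀ x, d z x < 1 / (4 * A₀ ^ 2) * δ ^ k → π k x = z := by
    intro k z hz x hx
    rw [← hπpar]
    refine hp.eq_of_dist_lt k _ z hz ?_
    have h1 := hdist (k + 1) x
    rw [hq.symm, zpow_add_one₀ hδ.ne'] at h1
    rw [hq.symm] at hx
    refine hq.dist_lt h1 hx.le ?_
    have h2 : A₀ * (2 * A₀ * (δ ^ k * δ) + 1 / (4 * A₀ ^ 2) * δ ^ k) =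
        (8 * A₀ ^ 3 * δ + 1) * (δ ^ k / (4 * A₀)) := by
      field_simp
      ring
    have h3 : δ ^ k / (2 * A₀) = 2 * (δ ^ k / (4 * A₀)) := by
      field_simp
      ring
    rw [h2, h3]
    have := hpos k
    gcongr
    linarith
  have hself : ∀ k, ∀ z ∈ N k, π k z = z := fun k z hz =>
    hball k z hz z (by rw [hq.dist_self]; have := hpos k; positivity)
  have hsub : ∀ k z, π k ⁻¹' {z} ⊆ qball d z (2 * A₀ * δ ^ k) := by
    rintro k z x rfl
    change d (π k x) x < _
    rw [hq.symm]
    exact hdist k x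
  refine ⟨{
    δ_pos := hδ
    δ_lt_one := hδlt
    c₁_pos := by positivity
    c₁_le := by
      rw [div_le_iff₀ (by positivity)]
      nlinarith [one_le_pow₀ hA1 (n := 2)]
    centers := N
    cube := fun k z => π k ⁻¹' {z}
    countable_centers := hcount
    borel_cube := fun k z hz => (hπ k).2 z hz
    cover := fun k => Set.eq_univ_of_forall fun x =>
      Set.mem_iUnion₂.2 ⟨π k x, hmem k x, rfl⟩
    disjoint := fun k z _ w _ hzw => Set.disjoint_left.2 fun x hx hx' =>
      hzw (Eq.trans (Eq.symm hx) hx')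
    nested := fun k l hkl z _ w _ => by
      by_cases hne : Disjoint (π k ⁻¹' {z}) (π l ⁻¹' {w})
      · exact Or.inr hne
      · obtain ⟨y, hy, hy'⟩ := Set.not_disjoint_iff.1 hne
        exact Or.inl fun x hx => (hanc k l hkl x y (Eq.trans hx (Eq.symm hy'))).trans hy
    ancestor := fun k l hlk z hz => by
      refine ⟨π l z, ⟨hmem l z, fun x hx => ?_⟩, fun w hw => ?_⟩
      · exact hanc l k hlk x z (Eq.trans hx (hself k z hz).symm)
      · exact (hw.2 (hself k z hz) : π l z = w).symm
    card_children := fun k z _ => by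
      refine h.encard_le (hpos (k + 1)) (by positivity)
        ((hN.sep (k + 1)).mono fun w hw => hw.1) (x := z) fun w hw => ?_
      have h1 := hsub k z (hw.2 (hself (k + 1) w hw.1))
      rw [zpow_add_one₀ hδ.ne']
      have h2 : 2 * A₀ / δ * (δ ^ k * δ) = 2 * A₀ * δ ^ k := by field_simp
      rwa [h2]
    union_children := fun k z _ => by
      refine Set.Subset.antisymm (fun x hx => ?_) (Set.iUnion₂_subset fun w hw => hw.2)
      refine Set.mem_iUnion₂.2 ⟨π (k + 1) x, ⟨hmem _ x, fun y hy => ?_⟩, rfl⟩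
      exact (hanc k (k + 1) (by omega) y x hy).trans hx
    ball_subset := fun k z hz x hx => hball k z hz x hx
    subset_ball := fun k z _ => (hsub k z).trans (qball_mono
      (mul_le_mul_of_nonneg_right (by nlinarith) (hpos k).le))
    ball_mono := fun k l hkl z hz w hw hwz => by
      have hwk : π k w = z := hwz (hself l w hw)
      rcases hkl.eq_or_lt with rfl | hlt
      · rw [← hwk, hself k w hw]
      · refine hq.qball_subset (r := 2 * A₀ * δ ^ k) (hsub k z hwk).le ?_
        have h1 : δ ^ l ≤ δ ^ k * δ := by
          rw [← zpow_add_one₀ hδ.ne']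
          exact zpow_le_zpow_right_of_le_one₀ hδ hδlt.le (by omega)
        have h2 : A₀ * (2 * A₀ * δ ^ k + 4 * A₀ ^ 2 * δ ^ l) ≤
            A₀ * (2 * A₀ * δ ^ k + 4 * A₀ ^ 2 * (δ ^ k * δ)) := by gcongr
        have h3 : A₀ * (2 * A₀ * δ ^ k + 4 * A₀ ^ 2 * (δ ^ k * δ)) =
            2 * A₀ ^ 2 * δ ^ k * (1 + 2 * A₀ * δ) := by ring
        have h4 : 2 * A₀ ^ 2 * δ ^ k * (1 + 2 * A₀ * δ) ≤ 2 * A₀ ^ 2 * δ ^ k * 2 := by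
          have := hpos k
          gcongr
          linarith
        linarith }, rfl⟩

/-- Adjacent systems: for each generation `k`, the centers of the different systems together
are `δ ^ (k + 1)`-dense, so every ball of radius at most `δ ^ (k + 2)` is deep inside one of the
cubes. -/
theorem IsSpaceOfHomogeneousType.exists_isAdjacent (h : IsSpaceOfHomogeneousType d μ A₀ Cμ)
    (hδ : 0 < δ) (hδA : 8 * A₀ ^ 3 * δ ≤ 1) :
    ∃ D : Fin (sepCard A₀ Cμ (1 / δ) + 1) → DyadicSystem d δ (1 / (4 * A₀ ^ 2)) (4 * A₀ ^ 2)
        (sepCard A₀ Cμ (2 * A₀ / δ)), IsAdjacent A₀ (A₀ * (1 + 4 * A₀ ^ 2) / δ ^ 3) D := by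
  have hq := h.quasiMetric
  have hA := hq.pos
  have hA1 := hq.one_le
  have hA3 := one_le_pow₀ hA1 (n := 3)
  have hδlt : δ < 1 := by nlinarith
  have hpos : ∀ k : ℤ, 0 < δ ^ k := fun k => zpow_pos hδ k
  choose N hN hNd using fun k : ℤ =>
    h.exists_nets (s := δ ^ (k + 1)) (ρ := 1 / δ) (hpos (k + 1)) (by positivity)
  have hs : ∀ k : ℤ, 1 / δ * δ ^ (k + 1) = δ ^ k := fun k => by
    rw [zpow_add_one₀ hδ.ne']
    field_simp
  simp only [hs] at hN
  have hex : ∀ t, ∃ D : DyadicSystem d δ (1 / (4 * A₀ ^ 2)) (4 * A₀ ^ 2)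
      (sepCard A₀ Cμ (2 * A₀ / δ)), D.centers = fun k => N k t := fun t =>
    IsNetFamily.exists_dyadicSystem ⟨fun k => (hN k t).1, fun k => (hN k t).2⟩ h hδ hδA
  choose D hD using hex
  refine ⟨D, ?_, fun x r k hr hr' => ?_⟩
  · rw [le_div_iff₀ (by positivity), one_mul]
    have : δ ^ 3 ≤ 1 := pow_le_one₀ hδ.le hδlt.le
    nlinarith
  · obtain ⟨t, z, hz, hxz⟩ := hNd k x
    have hz' : z ∈ (D t).centers k := by rw [hD]; exact hz
    have hk := hpos k
    have e1 : δ ^ (k + 1) = δ ^ k * δ := zpow_add_one₀ hδ.ne' k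
    have e2 : δ ^ (k + 2) ≤ δ ^ k * δ := by
      rw [← e1]
      exact zpow_le_zpow_right_of_le_one₀ hδ hδlt.le (by omega)
    have e3 : δ ^ (k + 3) = δ ^ k * δ ^ 3 := by
      rw [zpow_add₀ hδ.ne']
      norm_cast
    rw [e1] at hxz
    refine ⟨t, z, hz', ?_, ?_, ?_⟩
    · nlinarith
    · refine Set.Subset.trans ?_ ((D t).ball_subset k z hz')
      rw [hq.symm] at hxz
      refine hq.qball_subset hxz.le ?_
      have h1 : A₀ * (δ ^ k * δ + r) ≤ A₀ * (δ ^ k * δ + δ ^ k * δ) := by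
        gcongr
        linarith
      have h2 : A₀ * (δ ^ k * δ + δ ^ k * δ) =
          8 * A₀ ^ 3 * δ * (1 / (4 * A₀ ^ 2) * δ ^ k) := by
        field_simp
        ring
      have h3 : 8 * A₀ ^ 3 * δ * (1 / (4 * A₀ ^ 2) * δ ^ k) ≤
          1 * (1 / (4 * A₀ ^ 2) * δ ^ k) := by gcongr
      linarith
    · refine ((D t).subset_ball k z hz').trans (hq.qball_subset hxz.le ?_)
      have h1 : A₀ * (δ ^ k * δ + 4 * A₀ ^ 2 * δ ^ k) ≤ A₀ * (δ ^ k * 1 + 4 * A₀ ^ 2 * δ ^ k) := by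
        gcongr
      have h2 : A₀ * (δ ^ k * 1 + 4 * A₀ ^ 2 * δ ^ k) =
          A₀ * (1 + 4 * A₀ ^ 2) / δ ^ 3 * (δ ^ k * δ ^ 3) := by
        field_simp
      rw [h2, ← e3] at h1
      refine h1.trans ?_
      gcongr

end Construction

end HomogType

/-! ### Dyadic cubes, the dyadic maximal function and stopping cubes -/

namespace HomogType

variable {X : Type u} {d : X → X → ℝ} {A₀ δ c₁ C₁ : ℝ} {Cμ : ℝ≥0} {M : ℕ}

namespace DyadicSystem

theorem exists_mem_cube (D : DyadicSystem d δ c₁ C₁ M) (k : ℤ) (x : X) :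
    ∃ z ∈ D.centers k, x ∈ D.cube k z := by
  have := (D.cover k).ge (Set.mem_univ x)
  simpa using this

/-- The cube of generation `k` containing the point `x`. -/
noncomputable def cubeAt (D : DyadicSystem d δ c₁ C₁ M) (k : ℤ) (x : X) : Set X :=
  D.cube k (D.exists_mem_cube k x).choose

variable (D : DyadicSystem d δ c₁ C₁ M)

theorem mem_cubeAt (k : ℤ) (x : X) : x ∈ D.cubeAt k x := (D.exists_mem_cube k x).choose_spec.2

theorem cubeAt_mem_cubes (k : ℤ) (x : X) : D.cubeAt k x ∈ D.cubes :=
  ⟨k, _, (D.exists_mem_cube k x).choose_spec.1, rfl⟩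

theorem cubeAt_eq {k : ℤ} {x z : X} (hz : z ∈ D.centers k) (hx : x ∈ D.cube k z) :
    D.cubeAt k x = D.cube k z := by
  have hs := (D.exists_mem_cube k x).choose_spec
  by_contra hne
  refine Set.disjoint_left.1 (D.disjoint k hs.1 hz ?_) hs.2 hx
  rintro h
  exact hne (congrArg (D.cube k) h)

theorem exists_eq_cubeAt {Q : Set X} (hQ : Q ∈ D.cubes) {x : X} (hx : x ∈ Q) :
    ∃ k, Q = D.cubeAt k x := by
  obtain ⟨k, z, hz, rfl⟩ := hQ
  exact ⟨k, (D.cubeAt_eq hz hx).symm⟩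

theorem cubeAt_eq_of_mem {k : ℤ} {x y : X} (hy : y ∈ D.cubeAt k x) :
    D.cubeAt k y = D.cubeAt k x :=
  D.cubeAt_eq (D.exists_mem_cube k x).choose_spec.1 hy

theorem cubeAt_anti (x : X) : Antitone fun k => D.cubeAt k x := by
  intro k l hkl
  refine (D.nested k l hkl _ (D.exists_mem_cube k x).choose_spec.1 _
    (D.exists_mem_cube l x).choose_spec.1).resolve_right ?_
  exact Set.not_disjoint_iff.2 ⟨x, D.mem_cubeAt k x, D.mem_cubeAt l x⟩

theorem subset_or_subset {P Q : Set X} (hP : P ∈ D.cubes) (hQ : Q ∈ D.cubes) {x : X}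
    (hxP : x ∈ P) (hxQ : x ∈ Q) : P ⊆ Q ∨ Q ⊆ P := by
  obtain ⟨k, rfl⟩ := D.exists_eq_cubeAt hP hxP
  obtain ⟨l, rfl⟩ := D.exists_eq_cubeAt hQ hxQ
  exact (le_total l k).imp (fun h => D.cubeAt_anti x h) fun h => D.cubeAt_anti x h

theorem exists_eq_cubeAt_add {k : ℤ} {p x : X} {Q : Set X} (hQ : Q ∈ D.cubes) (hx : x ∈ Q)
    (hQp : Q ⊆ D.cubeAt k p) : ∃ n : ℕ, Q = D.cubeAt (k + n) x := by
  obtain ⟨l, rfl⟩ := D.exists_eq_cubeAt hQ hx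
  rcases le_total k l with hkl | hkl
  · exact ⟨(l - k).toNat, by congr 1; omega⟩
  · refine ⟨0, Set.Subset.antisymm ?_ ?_⟩
    · rw [← D.cubeAt_eq_of_mem (hQp hx)] at hQp
      simpa using hQp
    · simpa using D.cubeAt_anti x hkl

theorem countable_cubes : D.cubes.Countable := by
  have : D.cubes = ⋃ k, D.cube k '' D.centers k := by
    ext Q
    simp only [cubes, Set.mem_ofPred_eq, Set.mem_iUnion, Set.mem_image]
    exact exists_congr fun k => exists_congr fun z => and_congr_right fun _ => eq_comm
  rw [this]
  exact Set.countable_iUnion fun k => (D.countable_centers k).image _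

theorem isSep_centers (hq : IsQuasiMetric d A₀) (k : ℤ) :
    IsSep d (c₁ * δ ^ k) (D.centers k) := by
  intro z hz w hw hzw
  by_contra! hlt
  have hpos : 0 < c₁ * δ ^ k := mul_pos D.c₁_pos (zpow_pos D.δ_pos k)
  exact Set.disjoint_left.1 (D.disjoint k hz hw hzw) (D.ball_subset k z hz hlt)
    (D.ball_subset k w hw (hq.mem_qball_self hpos))

theorem center_mem (hq : IsQuasiMetric d A₀) {k : ℤ} {z : X} (hz : z ∈ D.centers k) :
    z ∈ D.cube k z :=
  D.ball_subset k z hz (hq.mem_qball_self (mul_pos D.c₁_pos (zpow_pos D.δ_pos k)))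

theorem nonempty_of_mem_cubes (hq : IsQuasiMetric d A₀) {Q : Set X} (hQ : Q ∈ D.cubes) :
    Q.Nonempty := by
  obtain ⟨k, z, hz, rfl⟩ := hQ
  exact ⟨z, D.center_mem hq hz⟩

section Measure

variable [MeasurableSpace X] {μ : Measure X}

theorem measurableSet_cube (h : IsSpaceOfHomogeneousType d μ A₀ Cμ) {Q : Set X}
    (hQ : Q ∈ D.cubes) : MeasurableSet Q := by
  obtain ⟨k, z, hz, rfl⟩ := hQ
  exact MeasurableSpace.generateFrom_le (fun U hU => h.measurableSet_of_isOpen U hU) _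
    (D.borel_cube k z hz)

theorem measure_cube_pos (h : IsSpaceOfHomogeneousType d μ A₀ Cμ) {Q : Set X}
    (hQ : Q ∈ D.cubes) : 0 < μ Q := by
  obtain ⟨k, z, hz, rfl⟩ := hQ
  exact (h.measure_qball_pos z (mul_pos D.c₁_pos (zpow_pos D.δ_pos k))).trans_le
    (measure_mono (D.ball_subset k z hz))

theorem measure_cube_lt_top (h : IsSpaceOfHomogeneousType d μ A₀ Cμ) {Q : Set X}
    (hQ : Q ∈ D.cubes) : μ Q < ∞ := by
  obtain ⟨k, z, hz, rfl⟩ := hQ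
  exact (measure_mono (D.subset_ball k z hz)).trans_lt
    (h.qball_lt_top z _ (mul_pos (D.c₁_pos.trans_le D.c₁_le) (zpow_pos D.δ_pos k)))

/-- A cube and its children have comparable measures. -/
theorem measure_cubeAt_le (h : IsSpaceOfHomogeneousType d μ A₀ Cμ) (k : ℤ) {x y : X}
    (hy : y ∈ D.cubeAt k x) :
    μ (D.cubeAt k x) ≤ ballRatio Cμ (2 * A₀ * C₁ / (c₁ * δ)) * μ (D.cubeAt (k + 1) y) := by
  have hq := h.quasiMetric
  have hδ := D.δ_pos
  have hc₁ := D.c₁_pos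
  have hk : 0 < δ ^ (k + 1) := zpow_pos hδ _
  obtain ⟨z, hz, hxz⟩ := D.exists_mem_cube k x
  obtain ⟨w, hw, hyw⟩ := D.exists_mem_cube (k + 1) y
  rw [D.cubeAt_eq hz hxz, D.cubeAt_eq hw hyw]
  rw [D.cubeAt_eq hz hxz] at hy
  have hwz : w ∈ D.cube k z := by
    rw [← D.cubeAt_eq hz hy]
    refine D.cubeAt_anti y (show k ≤ k + 1 by omega) ?_
    change w ∈ D.cubeAt (k + 1) y
    rw [D.cubeAt_eq hw hyw]
    exact D.center_mem hq hw
  have hdist : d z w < C₁ * δ ^ k := D.subset_ball k z hz hwz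
  rw [hq.symm] at hdist
  calc μ (D.cube k z) ≤ μ (qball d w (2 * A₀ * C₁ / (c₁ * δ) * (c₁ * δ ^ (k + 1)))) := by
        refine measure_mono ((D.subset_ball k z hz).trans (hq.qball_subset hdist.le ?_))
        apply le_of_eq
        rw [zpow_add_one₀ hδ.ne']
        field_simp
        ring
    _ ≤ _ := h.measure_qball_mul_le w (mul_pos hc₁ hk) _
    _ ≤ _ := by
        gcongr
        exact D.ball_subset (k + 1) w hw

end Measure

end DyadicSystem

section Mean

variable [MeasurableSpace X] {μ : Measure X}

/-- The mean over `Q` of a function with values in `[0, ∞]`. -/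
noncomputable def mean (μ : Measure X) (Q : Set X) (g : X → ℝ≥0∞) : ℝ≥0∞ :=
  (μ Q)⁻¹ * ∫⁻ y in Q, g y ∂μ

theorem mean_mul_measure {Q : Set X} (h0 : μ Q ≠ 0) (htop : μ Q ≠ ∞) (g : X → ℝ≥0∞) :
    mean μ Q g * μ Q = ∫⁻ y in Q, g y ∂μ := by
  rw [mean, mul_comm, ← mul_assoc, ENNReal.mul_inv_cancel h0 htop, one_mul]

/-- The weak type `(1, 1)` inequality for the dyadic maximal function: the cubes inside `P` on
which the mean of `g` is large are covered by the maximal ones among them, which are disjoint. -/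
theorem DyadicSystem.measure_sUnion_le (D : DyadicSystem d δ c₁ C₁ M)
    (h : IsSpaceOfHomogeneousType d μ A₀ Cμ) {P : Set X} (hP : P ∈ D.cubes)
    (g : X → ℝ≥0∞) {K : ℝ≥0∞} (hK : K ≠ 0) :
    K * μ (⋃₀ {Q ∈ D.cubes | Q ⊆ P ∧ K * mean μ P g < mean μ Q g}) ≤ μ P := by
  set 𝓑 := {Q ∈ D.cubes | Q ⊆ P ∧ K * mean μ P g < mean μ Q g} with h𝓑
  have hpos : ∀ Q ∈ D.cubes, μ Q ≠ 0 := fun Q hQ => (D.measure_cube_pos h hQ).ne'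
  have hfin : ∀ Q ∈ D.cubes, μ Q ≠ ∞ := fun Q hQ => (D.measure_cube_lt_top h hQ).ne
  rcases 𝓑.eq_empty_or_nonempty with hemp | ⟨Q₀, hQ₀⟩
  · simp [hemp]
  have hPtop : mean μ P g ≠ ∞ := fun ht => by
    have := hQ₀.2.2
    rw [ht, ENNReal.mul_top hK] at this
    exact not_top_lt this
  have hP0 : mean μ P g ≠ 0 := fun h0 => by
    have h1 := mean_mul_measure (hpos P hP) (hfin P hP) g
    rw [h0, zero_mul] at h1
    have h2 : ∫⁻ y in Q₀, g y ∂μ = 0 :=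
      le_antisymm ((lintegral_mono_set hQ₀.2.1).trans h1.ge) bot_le
    have : mean μ Q₀ g = 0 := by rw [mean, h2, mul_zero]
    exact not_lt_bot (this ▸ hQ₀.2.2)
  set 𝓜 := {Q ∈ 𝓑 | ∀ Q' ∈ 𝓑, Q ⊆ Q' → Q' ⊆ Q} with h𝓜
  have hcov : ⋃₀ 𝓑 ⊆ ⋃₀ 𝓜 := by
    classical
    rintro x ⟨Q, hQ, hxQ⟩
    obtain ⟨p, hp⟩ := D.nonempty_of_mem_cubes h.quasiMetric hP
    obtain ⟨k, hk⟩ := D.exists_eq_cubeAt hP hp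
    have hex : ∀ Q ∈ 𝓑, x ∈ Q → ∃ n : ℕ, Q = D.cubeAt (k + n) x := fun Q hQ hxQ =>
      D.exists_eq_cubeAt_add hQ.1 hxQ (hk ▸ hQ.2.1)
    have hex' : ∃ n : ℕ, D.cubeAt (k + n) x ∈ 𝓑 := by
      obtain ⟨n, hn⟩ := hex Q hQ hxQ
      exact ⟨n, hn ▸ hQ⟩
    refine ⟨_, ⟨Nat.find_spec hex', fun Q' hQ' hle => ?_⟩, D.mem_cubeAt _ _⟩
    obtain ⟨n, rfl⟩ := hex Q' hQ' (hle (D.mem_cubeAt _ _))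
    have := Nat.find_min' hex' hQ'
    exact D.cubeAt_anti x (by simpa using this)
  have hdisj : 𝓜.PairwiseDisjoint id := by
    intro Q hQ Q' hQ' hne
    refine Set.disjoint_left.2 fun x hx hx' => hne ?_
    rcases D.subset_or_subset hQ.1.1 hQ'.1.1 hx hx' with hle | hle
    · exact Set.Subset.antisymm hle (hQ.2 Q' hQ'.1 hle)
    · exact Set.Subset.antisymm (hQ'.2 Q hQ.1 hle) hle
  have hcount : 𝓜.Countable := D.countable_cubes.mono fun Q hQ => hQ.1.1
  have hmeas : ∀ Q ∈ 𝓜, MeasurableSet Q := fun Q hQ => D.measurableSet_cube h hQ.1.1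
  have hsum : mean μ P g * (K * μ (⋃₀ 𝓜)) ≤ mean μ P g * μ P :=
    calc mean μ P g * (K * μ (⋃₀ 𝓜)) = ∑' Q : 𝓜, K * mean μ P g * μ (Q : Set X) := by
          rw [measure_sUnion hcount hdisj hmeas, ENNReal.tsum_mul_left, ← mul_assoc,
            mul_comm K]
      _ ≤ ∑' Q : 𝓜, ∫⁻ y in (Q : Set X), g y ∂μ := by
          refine ENNReal.tsum_le_tsum fun Q => ?_
          rw [← mean_mul_measure (hpos Q Q.2.1.1) (hfin Q Q.2.1.1)]
          exact mul_le_mul_left (Q.2.1.2.2.le) _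
      _ = ∫⁻ y in ⋃₀ 𝓜, g y ∂μ := by
          rw [Set.sUnion_eq_biUnion, lintegral_biUnion hcount hmeas hdisj]
      _ ≤ ∫⁻ y in P, g y ∂μ := lintegral_mono_set (Set.sUnion_subset fun Q hQ => hQ.1.2.1)
      _ = mean μ P g * μ P := (mean_mul_measure (hpos P hP) (hfin P hP) g).symm
  calc K * μ (⋃₀ 𝓑) ≤ K * μ (⋃₀ 𝓜) := by gcongr
    _ ≤ μ P := (ENNReal.mul_le_mul_iff_right hP0 hPtop).1 hsum

end Mean

section Stopping

variable (D : DyadicSystem d δ c₁ C₁ M) (J : Set X → Set X → Prop) (k : ℤ)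

open scoped Classical in
/-- The stopping cubes for the relation `J`: along the decreasing sequence of the cubes
containing `x`, starting with generation `k`, the current stopping cube `Q` is replaced by the
cube `Q'` reached as soon as `J Q Q'` holds. The value at `n` is the stopping cube current at
generation `k + n`. -/
noncomputable def DyadicSystem.stopCube : ℕ → X → Set X
  | 0, x => D.cubeAt k x
  | n + 1, x =>
    if J (stopCube n x) (D.cubeAt (k + (n + 1 : ℕ)) x) then D.cubeAt (k + (n + 1 : ℕ)) x
    else stopCube n x

namespace DyadicSystem

theorem exists_stopCube_eq (n : ℕ) (x : X) :
    ∃ i ≤ n, D.stopCube J k n x = D.cubeAt (k + i) x ∧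
      D.stopCube J k i x = D.cubeAt (k + i) x := by
  induction n with
  | zero => exact ⟨0, le_rfl, by simp [stopCube], by simp [stopCube]⟩
  | succ n ih =>
    by_cases hJ : J (D.stopCube J k n x) (D.cubeAt (k + (n + 1 : ℕ)) x)
    · exact ⟨n + 1, le_rfl, by rw [stopCube, if_pos hJ], by rw [stopCube, if_pos hJ]⟩
    · obtain ⟨i, hi, h1, h2⟩ := ih
      exact ⟨i, hi.trans n.le_succ, by rw [stopCube, if_neg hJ, h1], h2⟩

theorem cubeAt_subset_stopCube (n : ℕ) (x : X) : D.cubeAt (k + n) x ⊆ D.stopCube J k n x := by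
  obtain ⟨i, hi, h1, -⟩ := D.exists_stopCube_eq J k n x
  rw [h1]
  exact D.cubeAt_anti x (by simpa using hi)

theorem stopCube_subset (n : ℕ) (x : X) : D.stopCube J k n x ⊆ D.cubeAt k x := by
  obtain ⟨i, hi, h1, -⟩ := D.exists_stopCube_eq J k n x
  rw [h1]
  exact D.cubeAt_anti x (by simp)

theorem mem_stopCube (n : ℕ) (x : X) : x ∈ D.stopCube J k n x :=
  D.cubeAt_subset_stopCube J k n x (D.mem_cubeAt _ x)

theorem stopCube_mem_cubes (n : ℕ) (x : X) : D.stopCube J k n x ∈ D.cubes := by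
  obtain ⟨i, -, h1, -⟩ := D.exists_stopCube_eq J k n x
  rw [h1]
  exact D.cubeAt_mem_cubes _ x

theorem stopCube_eq_of_mem {n : ℕ} {x y : X} (hy : y ∈ D.cubeAt (k + n) x) :
    D.stopCube J k n y = D.stopCube J k n x := by
  induction n with
  | zero => simpa [stopCube] using D.cubeAt_eq_of_mem hy
  | succ n ih =>
    have hy' : y ∈ D.cubeAt (k + n) x := D.cubeAt_anti x (by push_cast; omega) hy
    rw [stopCube, stopCube, ih hy', D.cubeAt_eq_of_mem hy]

/-- A stopping cube strictly inside another one, `P`, is inside a cube at which the construction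
leaves `P`. -/
theorem exists_of_stopCube_ssubset {m n : ℕ} {x y : X}
    (hlt : D.stopCube J k n x ⊂ D.stopCube J k m y) :
    ∃ Q ∈ D.cubes, Q ⊆ D.stopCube J k m y ∧ J (D.stopCube J k m y) Q ∧
      D.stopCube J k n x ⊆ Q := by
  obtain ⟨m, -, hm, hm'⟩ := D.exists_stopCube_eq J k m y
  obtain ⟨n, -, hn, hn'⟩ := D.exists_stopCube_eq J k n x
  rw [hm, hn] at hlt ⊢
  have hxm : x ∈ D.cubeAt (k + m) y := hlt.1 (D.mem_cubeAt _ x)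
  have hsm : D.stopCube J k m x = D.cubeAt (k + m) y := by
    rw [D.stopCube_eq_of_mem J k hxm, hm']
  rw [← D.cubeAt_eq_of_mem hxm] at hlt hsm ⊢
  have hmn : m ≤ n := by
    by_contra! hnm
    exact hlt.2 (D.cubeAt_anti x (by omega))
  have hexit : ∀ l, m ≤ l → D.stopCube J k l x ≠ D.cubeAt (k + m) x →
      ∃ j, m ≤ j ∧ j + 1 ≤ l ∧ J (D.cubeAt (k + m) x) (D.cubeAt (k + (j + 1 : ℕ)) x) := by
    intro l hl
    induction l, hl using Nat.le_induction with
    | base => exact fun hne => (hne hsm).elim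
    | succ l hl ih =>
      intro hne
      by_cases hl' : D.stopCube J k l x = D.cubeAt (k + m) x
      · by_cases hJ : J (D.stopCube J k l x) (D.cubeAt (k + (l + 1 : ℕ)) x)
        · exact ⟨l, hl, le_rfl, hl' ▸ hJ⟩
        · rw [stopCube, if_neg hJ] at hne
          exact (hne hl').elim
      · obtain ⟨j, h1, h2, h3⟩ := ih hl'
        exact ⟨j, h1, h2.trans l.le_succ, h3⟩
  obtain ⟨j, h1, h2, h3⟩ := hexit n hmn (by rw [hn']; exact hlt.ne)
  exact ⟨_, D.cubeAt_mem_cubes _ x, D.cubeAt_anti x (by push_cast; omega), h3,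
    D.cubeAt_anti x (by push_cast; omega)⟩

end DyadicSystem

end Stopping

end HomogType

/-! ### Sparse domination for one dyadic system -/

namespace HomogType

variable {X : Type u} {d : X → X → ℝ} {A₀ δ c₁ C₁ : ℝ} {Cμ : ℝ≥0} {M : ℕ}
  [MeasurableSpace X] {μ : Measure X}

section Packing

/-- If each member of `S` has a large part disjoint from the members strictly inside it, then `S`
satisfies a Carleson packing condition. -/
theorem DyadicSystem.tsum_measure_le (D : DyadicSystem d δ c₁ C₁ M)
    (h : IsSpaceOfHomogeneousType d μ A₀ Cμ) {S : Set (Set X)} (hS : S ⊆ D.cubes) {Λ : ℝ≥0∞}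
    (hΛ : ∀ P ∈ S, μ P ≤ Λ * μ (P \ ⋃₀ {P' ∈ S | P' ⊂ P})) (Q : Set X) :
    ∑' P : {P : Set X // P ∈ S ∧ P ⊆ Q}, μ (P : Set X) ≤ Λ * μ Q := by
  have hSc : S.Countable := D.countable_cubes.mono hS
  have : Countable {P : Set X // P ∈ S ∧ P ⊆ Q} := by
    have : {P | P ∈ S ∧ P ⊆ Q}.Countable := hSc.mono (Set.sep_subset _ _)
    exact this.to_subtype
  let E : Set X → Set X := fun P => P \ ⋃₀ {P' ∈ S | P' ⊂ P}
  have hEmeas : ∀ P ∈ S, MeasurableSet (E P) := fun P hP =>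
    (D.measurableSet_cube h (hS hP)).diff (MeasurableSet.sUnion
      (hSc.mono (Set.sep_subset _ _)) fun P' hP' => D.measurableSet_cube h (hS hP'.1))
  have hEdisj : Pairwise (Function.onFun Disjoint
      fun P : {P : Set X // P ∈ S ∧ P ⊆ Q} => E P) := by
    intro P P' hne
    refine Set.disjoint_left.2 fun x hx hx' => ?_
    have hne' : (P : Set X) ≠ P' := fun he => hne (Subtype.ext he)
    rcases D.subset_or_subset (hS P.2.1) (hS P'.2.1) hx.1 hx'.1 with hle | hle
    · exact hx'.2 ⟨P, ⟨P.2.1, hle.ssubset_of_ne hne'⟩, hx.1⟩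
    · exact hx.2 ⟨P', ⟨P'.2.1, hle.ssubset_of_ne hne'.symm⟩, hx'.1⟩
  calc ∑' P : {P : Set X // P ∈ S ∧ P ⊆ Q}, μ (P : Set X)
      ≤ ∑' P : {P : Set X // P ∈ S ∧ P ⊆ Q}, Λ * μ (E P) :=
        ENNReal.tsum_le_tsum fun P => hΛ P P.2.1
    _ = Λ * μ (⋃ P : {P : Set X // P ∈ S ∧ P ⊆ Q}, E P) := by
        rw [ENNReal.tsum_mul_left, measure_iUnion hEdisj fun P => hEmeas P P.2.1]
    _ ≤ Λ * μ Q := by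
        gcongr
        exact Set.iUnion_subset fun P => Set.sdiff_subset.trans P.2.2

end Packing

section StoppingFamily

/-- The mean of `g Q` or of `‖f‖` over `P` is more than four times the one over `Q`; here
`g = |b - b_Q| |f|`. -/
def Jump (μ : Measure X) (b f : X → ℂ) (Q P : Set X) : Prop :=
  4 * mean μ Q (fun y => ‖f y‖ₑ) < mean μ P (fun y => ‖f y‖ₑ) ∨
    4 * mean μ Q (fun y => ‖b y - ⨍ z in Q, b z ∂μ‖ₑ * ‖f y‖ₑ) <
      mean μ P (fun y => ‖b y - ⨍ z in Q, b z ∂μ‖ₑ * ‖f y‖ₑ)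

/-- The ancestors of the cube of generation `k` containing `p`, and the stopping cubes inside
this cube. -/
def DyadicSystem.stoppingFamily (D : DyadicSystem d δ c₁ C₁ M) (μ : Measure X) (b f : X → ℂ)
    (k : ℤ) (p : X) : Set (Set X) :=
  {Q | ∃ l ≤ k, Q = D.cubeAt l p} ∪
    {Q | ∃ x ∈ D.cubeAt k p, ∃ n, Q = D.stopCube (Jump μ b f) k n x}

variable (D : DyadicSystem d δ c₁ C₁ M) (b f : X → ℂ) (k : ℤ) (p : X)

theorem DyadicSystem.stoppingFamily_subset : D.stoppingFamily μ b f k p ⊆ D.cubes := by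
  rintro Q (⟨l, -, rfl⟩ | ⟨x, -, n, rfl⟩)
  · exact D.cubeAt_mem_cubes l p
  · exact D.stopCube_mem_cubes _ _ n x

theorem DyadicSystem.measure_sUnion_jump_le (h : IsSpaceOfHomogeneousType d μ A₀ Cμ) {P : Set X}
    (hP : P ∈ D.cubes) : 2 * μ (⋃₀ {Q ∈ D.cubes | Q ⊆ P ∧ Jump μ b f P Q}) ≤ μ P := by
  set U₁ := ⋃₀ {Q ∈ D.cubes | Q ⊆ P ∧
    4 * mean μ P (fun y => ‖f y‖ₑ) < mean μ Q (fun y => ‖f y‖ₑ)} with hU₁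
  set U₂ := ⋃₀ {Q ∈ D.cubes | Q ⊆ P ∧
    4 * mean μ P (fun y => ‖b y - ⨍ z in P, b z ∂μ‖ₑ * ‖f y‖ₑ) <
      mean μ Q (fun y => ‖b y - ⨍ z in P, b z ∂μ‖ₑ * ‖f y‖ₑ)} with hU₂
  have h1 : 4 * μ U₁ ≤ μ P := D.measure_sUnion_le h hP _ (by norm_num)
  have h2 : 4 * μ U₂ ≤ μ P := D.measure_sUnion_le h hP _ (by norm_num)
  have hsub : ⋃₀ {Q ∈ D.cubes | Q ⊆ P ∧ Jump μ b f P Q} ⊆ U₁ ∪ U₂ := by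
    rintro x ⟨Q, ⟨hQ, hQP, hJ | hJ⟩, hx⟩
    · exact Or.inl ⟨Q, ⟨hQ, hQP, hJ⟩, hx⟩
    · exact Or.inr ⟨Q, ⟨hQ, hQP, hJ⟩, hx⟩
  have h3 : 2 * (2 * μ (⋃₀ {Q ∈ D.cubes | Q ⊆ P ∧ Jump μ b f P Q})) ≤ 2 * μ P :=
    calc 2 * (2 * μ (⋃₀ {Q ∈ D.cubes | Q ⊆ P ∧ Jump μ b f P Q}))
        ≤ 2 * (2 * (μ U₁ + μ U₂)) := by
          gcongr
          exact (measure_mono hsub).trans (measure_union_le _ _)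
      _ = 4 * μ U₁ + 4 * μ U₂ := by ring
      _ ≤ μ P + μ P := add_le_add h1 h2
      _ = 2 * μ P := by ring
  exact (ENNReal.mul_le_mul_iff_right (by norm_num) (by norm_num)).1 h3

/-- For a stopping cube this is the weak type inequality. If a proper ancestor `P` of the initial
cube `R` is represented with its largest possible generation, then all smaller members of the
family are inside the child of `P` containing `R`, and another child of `P` avoids them. -/
theorem DyadicSystem.measure_le_of_mem_stoppingFamily (h : IsSpaceOfHomogeneousType d μ A₀ Cμ)
    {P : Set X} (hP : P ∈ D.stoppingFamily μ b f k p) :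
    μ P ≤ ((ballRatio Cμ (2 * A₀ * C₁ / (c₁ * δ)) + 2 : ℕ) : ℝ≥0∞) *
      μ (P \ ⋃₀ {P' ∈ D.stoppingFamily μ b f k p | P' ⊂ P}) := by
  set S := D.stoppingFamily μ b f k p with hS
  set J := Jump μ b f with hJ
  have hPc : P ∈ D.cubes := D.stoppingFamily_subset b f k p hP
  have hPfin := (D.measure_cube_lt_top h hPc).ne
  by_cases hcur : ∃ x ∈ D.cubeAt k p, ∃ n, P = D.stopCube J k n x
  · obtain ⟨x, hx, n, hPx⟩ := hcur
    have hPR : P ⊆ D.cubeAt k p := by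
      rw [hPx, ← D.cubeAt_eq_of_mem hx]
      exact D.stopCube_subset J k n x
    have hsub : ⋃₀ {P' ∈ S | P' ⊂ P} ⊆ ⋃₀ {Q ∈ D.cubes | Q ⊆ P ∧ J P Q} := by
      rintro y ⟨P', ⟨hP', hlt⟩, hy⟩
      rcases hP' with ⟨l, hl, rfl⟩ | ⟨x', -, n', rfl⟩
      · exact (hlt.2 (hPR.trans (D.cubeAt_anti p hl))).elim
      · rw [hPx] at hlt ⊢
        obtain ⟨Q, hQ, hQP, hJQ, hle⟩ := D.exists_of_stopCube_ssubset J k hlt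
        exact ⟨Q, ⟨hQ, hQP, hJQ⟩, hle hy⟩
    set U := ⋃₀ {P' ∈ S | P' ⊂ P} with hU
    have h2 : 2 * μ U ≤ μ P :=
      (mul_le_mul_right (measure_mono hsub) 2).trans (D.measure_sUnion_jump_le b f h hPc)
    have hUP : U ⊆ P := Set.sUnion_subset fun P' hP' => hP'.2.1
    have h3 : μ P ≤ μ (P \ U) + μ U :=
      (measure_mono (by rw [Set.sdiff_union_self]; exact Set.subset_union_left)).trans
        (measure_union_le _ _)
    have h4 : μ P ≤ 2 * μ (P \ U) := by
      have hUfin : μ U ≠ ∞ := measure_ne_top_of_subset hUP hPfin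
      have hDfin : μ (P \ U) ≠ ∞ := measure_ne_top_of_subset Set.sdiff_subset hPfin
      lift μ U to ℝ≥0 using hUfin with u
      lift μ (P \ U) to ℝ≥0 using hDfin with v
      lift μ P to ℝ≥0 using hPfin with w
      norm_cast at h2 h3 ⊢
      rw [← NNReal.coe_le_coe] at h2 h3 ⊢
      push_cast at h2 h3 ⊢
      linarith
    refine h4.trans ?_
    gcongr
    push_cast
    exact le_add_self
  · obtain ⟨l₀, hl₀, hPl₀⟩ := hP.resolve_right hcur
    obtain ⟨l, ⟨hl, hPl⟩, hlmax⟩ := Int.exists_greatest_of_bdd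
      (P := fun l => l ≤ k ∧ P = D.cubeAt l p) ⟨k, fun l hl => hl.1⟩ ⟨l₀, hl₀, hPl₀⟩
    have hlk : l < k := by
      refine lt_of_le_of_ne hl fun he => hcur ⟨p, D.mem_cubeAt k p, 0, ?_⟩
      rw [hPl, he]
      rfl
    have hWP : D.cubeAt (l + 1) p ⊆ P := hPl ▸ D.cubeAt_anti p (by omega)
    have hPW : ¬ P ⊆ D.cubeAt (l + 1) p := fun hle => by
      have := hlmax (l + 1) ⟨by omega, Set.Subset.antisymm hle hWP⟩
      omega
    obtain ⟨y, hyP, hyW⟩ := Set.not_subset.1 hPW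
    have hsub : D.cubeAt (l + 1) y ⊆ P \ ⋃₀ {P' ∈ S | P' ⊂ P} := by
      rw [hPl] at hyP
      intro v hv
      refine ⟨?_, ?_⟩
      · rw [hPl, ← D.cubeAt_eq_of_mem hyP]
        exact D.cubeAt_anti y (show l ≤ l + 1 by omega) hv
      · rintro ⟨P', ⟨hP', hlt⟩, hvP'⟩
        have hP'W : P' ⊆ D.cubeAt (l + 1) p := by
          rcases hP' with ⟨i, hi, rfl⟩ | ⟨x, hx, n, rfl⟩
          · refine D.cubeAt_anti p ?_
            by_contra! hil
            exact hlt.2 (hPl ▸ D.cubeAt_anti p (by omega))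
          · refine (D.stopCube_subset J k n x).trans ?_
            rw [D.cubeAt_eq_of_mem hx]
            exact D.cubeAt_anti p (by omega)
        refine hyW ?_
        rw [← D.cubeAt_eq_of_mem (hP'W hvP'), D.cubeAt_eq_of_mem hv]
        exact D.mem_cubeAt _ y
    calc μ P ≤ ballRatio Cμ (2 * A₀ * C₁ / (c₁ * δ)) * μ (D.cubeAt (l + 1) y) := by
          rw [hPl] at hyP ⊢
          exact D.measure_cubeAt_le h l hyP
      _ ≤ _ := by
          gcongr
          omega

end StoppingFamily

section Domination

theorem enorm_mul_le_mean {b f : X → ℂ} (hf : AEStronglyMeasurable f μ) (Q : Set X) (c : ℂ)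
    (x : X) : mean μ Q (fun y => ‖b x - b y‖ₑ * ‖f y‖ₑ) ≤
      ‖b x - c‖ₑ * mean μ Q (fun y => ‖f y‖ₑ) +
        mean μ Q (fun y => ‖b y - c‖ₑ * ‖f y‖ₑ) := by
  have h1 : ∫⁻ y in Q, ‖b x - b y‖ₑ * ‖f y‖ₑ ∂μ ≤
      ‖b x - c‖ₑ * ∫⁻ y in Q, ‖f y‖ₑ ∂μ + ∫⁻ y in Q, ‖b y - c‖ₑ * ‖f y‖ₑ ∂μ := by
    rw [← lintegral_const_mul'' _ hf.enorm.restrict,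
      ← lintegral_add_left' (hf.enorm.restrict.const_mul _)]
    refine lintegral_mono fun y => ?_
    rw [← add_mul]
    gcongr
    have : b x - b y = (b x - c) - (b y - c) := by ring
    rw [this]
    exact enorm_sub_le
  calc mean μ Q (fun y => ‖b x - b y‖ₑ * ‖f y‖ₑ)
      ≤ (μ Q)⁻¹ * (‖b x - c‖ₑ * ∫⁻ y in Q, ‖f y‖ₑ ∂μ + ∫⁻ y in Q, ‖b y - c‖ₑ * ‖f y‖ₑ ∂μ) := by
        unfold mean
        gcongr
    _ = _ := by
        unfold mean
        ring

/-- Each sparse operator is at least its term for the single cube `Q`. -/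
theorem le_sparseOp_add_sparseOpAdj {b f : X → ℂ} {S : Set (Set X)} {Q : Set X} (hQ : Q ∈ S)
    {x : X} (hx : x ∈ Q) :
    ‖b x - ⨍ z in Q, b z ∂μ‖ₑ * mean μ Q (fun y => ‖f y‖ₑ) +
        mean μ Q (fun y => ‖b y - ⨍ z in Q, b z ∂μ‖ₑ * ‖f y‖ₑ) ≤
      sparseOp μ S b f x + sparseOpAdj μ S b f x := by
  refine add_le_add ?_ ?_
  · refine le_trans ?_ (ENNReal.le_tsum (⟨Q, hQ⟩ : S))
    rw [Set.indicator_of_mem hx]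
    exact le_rfl
  · refine le_trans ?_ (ENNReal.le_tsum (⟨Q, hQ⟩ : S))
    rw [Set.indicator_of_mem hx]
    exact le_rfl

/-- Sparse domination of the dyadic maximal commutator of one dyadic system, for a function `f`
vanishing outside a ball. -/
theorem DyadicSystem.exists_sparse (D : DyadicSystem d δ c₁ C₁ M)
    (h : IsSpaceOfHomogeneousType d μ A₀ Cμ) (b : X → ℂ) {f : X → ℂ}
    (hf : AEStronglyMeasurable f μ) {x₀ : X} {ρ : ℝ}
    (hfρ : ∀ᵐ x ∂μ, x ∉ qball d x₀ ρ → f x = 0) :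
    ∃ S ⊆ D.cubes, (∀ Q, ∑' P : {P : Set X // P ∈ S ∧ P ⊆ Q}, μ (P : Set X) ≤
        ((sepCard A₀ Cμ (A₀ * (1 + C₁) / c₁) *
          (ballRatio Cμ (2 * A₀ * C₁ / (c₁ * δ)) + 2) : ℕ) : ℝ≥0∞) * μ Q) ∧
      ∀ Q ∈ D.cubes, ∀ x ∈ Q, mean μ Q (fun y => ‖b x - b y‖ₑ * ‖f y‖ₑ) ≤
        4 * (sparseOp μ S b f x + sparseOpAdj μ S b f x) := by
  have hq := h.quasiMetric
  have hA := hq.pos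
  have hδ := D.δ_pos
  have hc₁ := D.c₁_pos
  have hC₁ : 0 < C₁ := hc₁.trans_le D.c₁_le
  obtain ⟨k, hk⟩ : ∃ k : ℤ, ρ ≤ δ ^ k := by
    obtain ⟨m, hm⟩ := pow_unbounded_of_one_lt ρ ((one_lt_inv₀ hδ).2 D.δ_lt_one)
    exact ⟨-m, by rw [zpow_neg, zpow_natCast, ← inv_pow]; exact hm.le⟩
  have hδk : 0 < δ ^ k := zpow_pos hδ k
  -- The cubes of a large generation `k` that meet the support of `f`; there are few of them.
  set Z := {z ∈ D.centers k | (D.cube k z ∩ qball d x₀ ρ).Nonempty} with hZ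
  have hZcard : Z.encard ≤ sepCard A₀ Cμ (A₀ * (1 + C₁) / c₁) := by
    refine h.encard_le (mul_pos hc₁ hδk) (by positivity)
      ((D.isSep_centers hq k).mono (Set.sep_subset _ _)) (x := x₀) ?_
    rintro z ⟨hz, y, hyz, hy⟩
    have h1 : d z y < C₁ * δ ^ k := D.subset_ball k z hz hyz
    rw [hq.symm] at h1
    refine hq.dist_lt (lt_of_lt_of_le hy hk) h1.le (le_of_eq ?_)
    field_simp
  have hZfin : Z.Finite := Set.finite_of_encard_le_coe hZcard
  set S := ⋃ z ∈ Z, D.stoppingFamily μ b f k z with hS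
  refine ⟨S, Set.iUnion₂_subset fun z _ => D.stoppingFamily_subset b f k z, fun Q => ?_,
    fun Q hQ x hx => ?_⟩
  · set Λ : ℕ := ballRatio Cμ (2 * A₀ * C₁ / (c₁ * δ)) + 2 with hΛ
    have hbd : ∀ z, ∑' P : {P : Set X // P ∈ D.stoppingFamily μ b f k z ∧ P ⊆ Q},
        μ (P : Set X) ≤ Λ * μ Q := fun z =>
      D.tsum_measure_le h (D.stoppingFamily_subset b f k z)
        (fun P hP => D.measure_le_of_mem_stoppingFamily b f k z h hP) Q
    lift Z to Finset X using hZfin with F hF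
    have hcard : (F.card : ℝ≥0∞) ≤ sepCard A₀ Cμ (A₀ * (1 + C₁) / c₁) := by
      rw [Set.encard_coe_eq_coe_finsetCard] at hZcard
      exact_mod_cast hZcard
    have he : {P : Set X | P ∈ S ∧ P ⊆ Q} =
        ⋃ z ∈ F, {P : Set X | P ∈ D.stoppingFamily μ b f k z ∧ P ⊆ Q} := by
      ext P
      simp only [hS, Set.mem_ofPred_eq, Set.mem_iUnion, exists_prop, Finset.mem_coe]
      tauto
    calc ∑' P : {P : Set X | P ∈ S ∧ P ⊆ Q}, μ (P : Set X)
        = ∑' P : ⋃ z ∈ F, {P : Set X | P ∈ D.stoppingFamily μ b f k z ∧ P ⊆ Q},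
            μ (P : Set X) := by rw [he]
      _ ≤ ∑ z ∈ F, ∑' P : {P : Set X | P ∈ D.stoppingFamily μ b f k z ∧ P ⊆ Q},
            μ (P : Set X) := ENNReal.tsum_biUnion_le _ _ _
      _ ≤ ∑ z ∈ F, Λ * μ Q := Finset.sum_le_sum fun z _ => hbd z
      _ = F.card * (Λ * μ Q) := by simp
      _ ≤ sepCard A₀ Cμ (A₀ * (1 + C₁) / c₁) * (Λ * μ Q) := by gcongr
      _ = _ := by push_cast; ring
  · rcases (Q ∩ qball d x₀ ρ).eq_empty_or_nonempty with hemp | ⟨y, hyQ, hy⟩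
    · -- `f` vanishes almost everywhere on `Q`.
      have h0 : ∫⁻ y in Q, ‖b x - b y‖ₑ * ‖f y‖ₑ ∂μ = 0 := by
        rw [setLIntegral_congr_fun_ae (g := fun _ => 0) (D.measurableSet_cube h hQ)]
        · simp
        · filter_upwards [hfρ] with y hy hyQ
          rw [hy fun hyρ => Set.eq_empty_iff_forall_notMem.1 hemp y ⟨hyQ, hyρ⟩]
          simp
      rw [mean, h0, mul_zero]
      exact bot_le
    have hmemS : ∀ v, (D.cubeAt k v ∩ qball d x₀ ρ).Nonempty → ∃ z ∈ Z,
        D.cubeAt k z = D.cubeAt k v := by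
      intro v hv
      obtain ⟨z, hz, hvz⟩ := D.exists_mem_cube k v
      rw [D.cubeAt_eq hz hvz] at hv ⊢
      exact ⟨z, ⟨hz, hv⟩, D.cubeAt_eq hz (D.center_mem hq hz)⟩
    -- It suffices to find a member of `S` whose means control those of `Q`.
    suffices hsuff : ∃ R ∈ S, x ∈ R ∧
        mean μ Q (fun y => ‖f y‖ₑ) ≤ 4 * mean μ R (fun y => ‖f y‖ₑ) ∧
        mean μ Q (fun y => ‖b y - ⨍ z in R, b z ∂μ‖ₑ * ‖f y‖ₑ) ≤
          4 * mean μ R (fun y => ‖b y - ⨍ z in R, b z ∂μ‖ₑ * ‖f y‖ₑ) by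
      obtain ⟨R, hR, hxR, h1, h2⟩ := hsuff
      calc mean μ Q (fun y => ‖b x - b y‖ₑ * ‖f y‖ₑ)
          ≤ ‖b x - ⨍ z in R, b z ∂μ‖ₑ * mean μ Q (fun y => ‖f y‖ₑ) +
            mean μ Q (fun y => ‖b y - ⨍ z in R, b z ∂μ‖ₑ * ‖f y‖ₑ) :=
            enorm_mul_le_mean hf Q _ x
        _ ≤ ‖b x - ⨍ z in R, b z ∂μ‖ₑ * (4 * mean μ R (fun y => ‖f y‖ₑ)) +
            4 * mean μ R (fun y => ‖b y - ⨍ z in R, b z ∂μ‖ₑ * ‖f y‖ₑ) := by gcongr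
        _ = 4 * (‖b x - ⨍ z in R, b z ∂μ‖ₑ * mean μ R (fun y => ‖f y‖ₑ) +
            mean μ R (fun y => ‖b y - ⨍ z in R, b z ∂μ‖ₑ * ‖f y‖ₑ)) := by ring
        _ ≤ _ := mul_le_mul_right (le_sparseOp_add_sparseOpAdj hR hxR) 4
    have hself : ∀ a : ℝ≥0∞, a ≤ 4 * a := fun a => by
      calc a = 1 * a := (one_mul a).symm
        _ ≤ 4 * a := by
          gcongr
          norm_num
    obtain ⟨l, rfl⟩ := D.exists_eq_cubeAt hQ hx
    rcases le_total l k with hlk | hlk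
    · have hyk : D.cubeAt k y ⊆ D.cubeAt l x := by
        rw [← D.cubeAt_eq_of_mem hyQ]
        exact D.cubeAt_anti y hlk
      obtain ⟨z, hz, hzy⟩ := hmemS y ⟨y, D.mem_cubeAt k y, hy⟩
      have hzl : D.cubeAt l x = D.cubeAt l z :=
        (D.cubeAt_eq_of_mem (hyk (hzy ▸ D.mem_cubeAt k z))).symm
      exact ⟨D.cubeAt l x, Set.mem_iUnion₂.2 ⟨z, hz, Or.inl ⟨l, hlk, hzl⟩⟩, hx, hself _, hself _⟩
    · obtain ⟨z, hz, hzx⟩ := hmemS x ⟨y, D.cubeAt_anti x hlk hyQ, hy⟩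
      obtain ⟨n, rfl⟩ : ∃ n : ℕ, l = k + n := ⟨(l - k).toNat, by omega⟩
      refine ⟨D.stopCube (Jump μ b f) k n x, Set.mem_iUnion₂.2 ⟨z, hz, Or.inr
        ⟨x, hzx ▸ D.mem_cubeAt k x, n, rfl⟩⟩, D.mem_stopCube _ k n x, ?_⟩
      rcases n with _ | n
      · have he : D.cubeAt (k + (0 : ℕ)) x = D.stopCube (Jump μ b f) k 0 x := by
          simp [stopCube]
        rw [he]
        exact ⟨hself _, hself _⟩
      · by_cases hJ : Jump μ b f (D.stopCube (Jump μ b f) k n x) (D.cubeAt (k + (n + 1 : ℕ)) x)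
        · have he : D.stopCube (Jump μ b f) k (n + 1) x = D.cubeAt (k + (n + 1 : ℕ)) x := by
            rw [stopCube, if_pos hJ]
          rw [he]
          exact ⟨hself _, hself _⟩
        · have he : D.stopCube (Jump μ b f) k (n + 1) x = D.stopCube (Jump μ b f) k n x := by
            rw [stopCube, if_neg hJ]
          rw [he]
          rw [Jump, not_or, not_lt, not_lt] at hJ
          exact hJ

end Domination

end HomogType

/-! ### From balls to cubes -/

namespace HomogType

variable {X : Type u} {d : X → X → ℝ} {A₀ δ c₁ C₁ Cadj : ℝ} {Cμ : ℝ≥0} {M T : ℕ}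
  [MeasurableSpace X] {μ : Measure X}

/-- Every ball is contained in a cube of one of the adjacent systems having comparable measure,
so the mean over the ball is controlled by the mean over the cube. -/
theorem IsAdjacent.exists_mean_le {D : Fin T → DyadicSystem d δ c₁ C₁ M}
    (hD : IsAdjacent A₀ Cadj D) (h : IsSpaceOfHomogeneousType d μ A₀ Cμ) (hδ : 0 < δ)
    (hδ1 : δ < 1) (z : X) {r : ℝ} (hr : 0 < r) (g : X → ℝ≥0∞) :
    ∃ t, ∃ Q ∈ (D t).cubes, qball d z r ⊆ Q ∧
      mean μ (qball d z r) g ≤ ballRatio Cμ Cadj * mean μ Q g := by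
  obtain ⟨n, hn, hn'⟩ := exists_mem_Ioc_zpow hr ((one_lt_inv₀ hδ).2 hδ1)
  rw [inv_zpow', neg_add] at hn'
  rw [inv_zpow'] at hn
  obtain ⟨t, w, hw, -, h1, h2⟩ := hD.2 z r (-n - 3)
    (by rwa [show -n - 3 + 3 = -n by ring]) (by rwa [show -n - 3 + 2 = -n + -1 by ring])
  have hQ : (D t).cube (-n - 3) w ∈ (D t).cubes := ⟨_, w, hw, rfl⟩
  refine ⟨t, _, hQ, h1, ?_⟩
  set Q := (D t).cube (-n - 3) w with hQdef
  have hμQ : μ Q ≤ ballRatio Cμ Cadj * μ (qball d z r) :=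
    (measure_mono h2).trans (h.measure_qball_mul_le z hr Cadj)
  have hB0 : μ (qball d z r) ≠ 0 := (h.measure_qball_pos z hr).ne'
  have hBtop : μ (qball d z r) ≠ ∞ := (h.qball_lt_top z r hr).ne
  have hQ0 : μ Q ≠ 0 := ((D t).measure_cube_pos h hQ).ne'
  have hQtop : μ Q ≠ ∞ := ((D t).measure_cube_lt_top h hQ).ne
  have hinv : (μ (qball d z r))⁻¹ ≤ ballRatio Cμ Cadj * (μ Q)⁻¹ :=
    calc (μ (qball d z r))⁻¹ = (μ (qball d z r))⁻¹ * (μ Q * (μ Q)⁻¹) := by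
          rw [ENNReal.mul_inv_cancel hQ0 hQtop, mul_one]
      _ ≤ (μ (qball d z r))⁻¹ * (ballRatio Cμ Cadj * μ (qball d z r) * (μ Q)⁻¹) := by gcongr
      _ = ballRatio Cμ Cadj * (μ Q)⁻¹ * (μ (qball d z r) * (μ (qball d z r))⁻¹) := by ring
      _ = ballRatio Cμ Cadj * (μ Q)⁻¹ := by rw [ENNReal.mul_inv_cancel hB0 hBtop, mul_one]
  calc mean μ (qball d z r) g
      ≤ ballRatio Cμ Cadj * (μ Q)⁻¹ * ∫⁻ y in Q, g y ∂μ := by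
        unfold mean
        gcongr
    _ = ballRatio Cμ Cadj * mean μ Q g := by rw [mean, mul_assoc]

end HomogType

theorem theorem3p1 (A₀ : ℝ) (Cμ : ℝ≥0) :
    ∃ (T M : ℕ) (δ c₁ C₁ Cadj η : ℝ) (C : ℝ≥0), 0 < η ∧ η < 1 ∧
      ∀ (X : Type u) [MeasurableSpace X] (d : X → X → ℝ) (μ : Measure X),
        HomogType.IsSpaceOfHomogeneousType d μ A₀ Cμ →
        ∀ b : X → ℂ, HomogType.LocallyInt d μ b →
        ∀ f : X → ℂ, MemLp f ∞ μ → HomogType.CompactlySupported d μ f →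
        ∃ D : Fin T → HomogType.DyadicSystem d δ c₁ C₁ M,
          HomogType.IsAdjacent A₀ Cadj D ∧
          ∃ S : Fin T → Set (Set X),
            (∀ t, HomogType.IsSparse μ (D t) η (S t)) ∧
            ∀ᵐ x ∂μ, HomogType.maximalCommutator d μ b f x ≤
              C * ∑ t, (HomogType.sparseOp μ (S t) b f x +
                HomogType.sparseOpAdj μ (S t) b f x) := by
  let δ : ℝ := 1 / (8 * A₀ ^ 3)
  let c₁ : ℝ := 1 / (4 * A₀ ^ 2)
  let C₁ : ℝ := 4 * A₀ ^ 2
  let Cadj : ℝ := A₀ * (1 + 4 * A₀ ^ 2) / δ ^ 3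
  let Λ : ℕ := HomogType.sepCard A₀ Cμ (A₀ * (1 + C₁) / c₁) *
    (HomogType.ballRatio Cμ (2 * A₀ * C₁ / (c₁ * δ)) + 2)
  -- `Λ` is the packing constant; adding `2` only makes `η` positive and smaller than `1`.
  refine ⟨HomogType.sepCard A₀ Cμ (1 / δ) + 1, HomogType.sepCard A₀ Cμ (2 * A₀ / δ), δ, c₁, C₁,
    Cadj, 1 / ((Λ : ℝ) + 2), HomogType.ballRatio Cμ Cadj * 4, by positivity, ?_, ?_⟩
  · rw [div_lt_one (by positivity)]
    linarith [(Nat.cast_nonneg Λ : (0 : ℝ) ≤ Λ)]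
  intro X _ d μ h b _ f hf hfK
  have hq := h.quasiMetric
  have hA := hq.pos
  have hδ : 0 < δ := by positivity
  have hδA : 8 * A₀ ^ 3 * δ ≤ 1 := by
    apply le_of_eq
    simp only [δ]
    field_simp
  have hδ1 : δ < 1 := by
    have := one_le_pow₀ hq.one_le (n := 3)
    nlinarith
  obtain ⟨D, hD⟩ := h.exists_isAdjacent hδ hδA
  refine ⟨D, hD, ?_⟩
  have hX : Nonempty X := by
    by_contra hX
    rw [not_nonempty_iff] at hX
    have := h.measure_univ
    rw [Set.univ_eq_empty_iff.2 hX, measure_empty] at this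
    exact ENNReal.zero_ne_top this
  obtain ⟨x₀⟩ := hX
  obtain ⟨K, hK, hfK⟩ := hfK
  obtain ⟨n, hn⟩ := hq.exists_subset_qball hK x₀
  have hfn : ∀ᵐ x ∂μ, x ∉ HomogType.qball d x₀ n → f x = 0 := by
    filter_upwards [hfK] with x hx hxn using hx fun hxK => hxn (hn hxK)
  choose S hSD hSp hSb using fun t => (D t).exists_sparse h b hf.1 hfn
  refine ⟨S, fun t => ⟨hSD t, fun Q _ => (hSp t Q).trans ?_⟩, Filter.Eventually.of_forall
    fun x => ?_⟩
  · gcongr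
    rw [one_div_one_div, ← ENNReal.ofReal_natCast]
    exact ENNReal.ofReal_le_ofReal (le_add_of_nonneg_right zero_le_two)
  · refine iSup_le fun z => iSup_le fun r => iSup_le fun hr => iSup_le fun hx => ?_
    obtain ⟨t, Q, hQ, hzQ, hle⟩ := hD.exists_mean_le h hδ hδ1 z hr
      (fun y => ‖b x - b y‖ₑ * ‖f y‖ₑ)
    refine hle.trans ?_
    push_cast
    rw [mul_assoc]
    gcongr
    refine (hSb t Q hQ x (hzQ hx)).trans ?_
    gcongr
    exact Finset.single_le_sum (f := fun t => HomogType.sparseOp μ (S t) b f x +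
      HomogType.sparseOpAdj μ (S t) b f x) (fun _ _ => bot_le) (Finset.mem_univ t)
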